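/- All graphs are finite and simple, with vertex set $\{1,\dots,n\}$ for some $n\ge 0$. A graph is an interval graph if its vertices can be assigned nonempty closed real intervals so that distinct vertices are adjacent iff their intervals intersect. An MPQ-tree is a rooted plane tree with two kinds of nodes. A P-node stores a list of vertices and has $k\ge 0$ ordered subtrees. A Q-node has $k\ge 3$ ordered sections, each section $i$ having a subtree $T_i$ (possibly the empty tree, i.e. a leaf P-node storing no vertices), a list of the vertices of the node whose first section is $i$, and a list of those whose last section is $i$; the section $S_i$ is the set of vertices of the node whose first section is at most $i$ and whose last section is at least $i$. Each vertex of a Q-node belongs to at least two, but not to all, of its sections. A P-node with exactly one subtree stores at least one vertex, and the root of its subtree is a Q-node. Each vertex is assigned to exactly one node. The frontier of the tree is the left-to-right sequence, over its leaves, of the sets of all vertices assigned to the P-nodes and sections on the path from the root to the leaf. Two trees are equivalent if one arises from the other by permuting the subtrees of P-nodes and reversing Q-nodes. Such a tree $\mathcal T$, using exactly the vertices of $G$, represents $G$ (is an MPQ-tree of $G$) if its frontier lists every maximal clique of $G$ exactly once, with the cliques containing any given vertex consecutive, and every ordering of the maximal cliques of $G$ with this consecutiveness property is the frontier of some tree equivalent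 to $\mathcal T$. The string representation of a tree is defined recursively. For a P-node it is the list of its vertices, followed by the strings of its subtrees from left to right, followed by the list of its vertices in reversed order. For a Q-node it is the concatenation over its sections $i$ of the list of vertices whose first section is $i$, the string of $T_i$, and the list of vertices whose last section is $i$. The normalized string representation of $\mathcal T$ is the lexicographically smallest string obtained from its string representation by applying a permutation of $\{1,\dots,n\}$ to all entries. Let $t_{\mathcal T}$ be the triple consisting of the number of vertices of $\mathcal T$, the number of vertices belonging to its root, and the number of children of its root. Write $\mathcal T\prec\mathcal T'$ if $t_{\mathcal T}$ is lexicographically smaller than $t_{\mathcal T'}$, or $t_{\mathcal T}=t_{\mathcal T'}$ and the normalized string representation of $\mathcal T$ is lexicographically not greater than that of $\mathcal T'$. An MPQ-tree $\mathcal T$ of $G$ is canonical if $\mathcal T\prec\mathcal T'$ for every MPQ-tree $\mathcal T'$ of $G$. A canonical string of $G$ is the normalized string representation of a canonical MPQ-tree of $G$. Theorem. Every interval graph has exactly one canonical string, and two interval graphs $G_1$ and $G_2$ (with possibly different numbers of vertices) are isomorphic if and only if their canonical strings $S_1$ and $S_2$ are equal. -/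

import Mathlib

/-- A finite graph is an interval graph if its vertices can be represented by intervals of the
real line so that distinct vertices are adjacent exactly when their intervals intersect. -/
def IsIntervalGraph {V : Type*} (G : SimpleGraph V) : Prop :=
  ∃ a b : V → ℝ, (∀ v, a v ≤ b v) ∧
    ∀ u v, u ≠ v → (G.Adj u v ↔ (Set.Icc (a u) (b u) ∩ Set.Icc (a v) (b v)).Nonempty)

/-- `L` is an ordering of all maximal cliques of `G` in which the cliques that contain any given
vertex are consecutive. -/
structure IsConsecutiveCliqueOrder {V : Type*} (G : SimpleGraph V) (L : List (Finset V)) :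
    Prop where
  nodup : L.Nodup
  mem_iff : ∀ C : Finset V, C ∈ L ↔ Maximal (fun s : Finset V => G.IsClique (s : Set V)) C
  consecutive : ∀ (v : V) (i j k : Fin L.length), i ≤ j → j ≤ k →
    v ∈ L.get i → v ∈ L.get k → v ∈ L.get j

/-- The plane trees underlying MPQ-trees, with nodes labelled by vertices from `V`.

* `P verts k child` is a P-node with `k` subtrees, storing the vertices `verts`. A leaf is a P-node
  without subtrees; the empty tree is a leaf which stores no vertices.
* `Q k left right child` is a Q-node with `k` sections. Every vertex of the node is stored only
  twice: `left i` lists the vertices whose first section is the `i`-th one and `right i` lists the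
  vertices whose last section is the `i`-th one; `child i` is the subtree of the `i`-th section. -/
inductive MPQTree (V : Type*) where
  | P (verts : List V) (k : ℕ) (child : Fin k → MPQTree V) : MPQTree V
  | Q (k : ℕ) (left right : Fin k → List V) (child : Fin k → MPQTree V) : MPQTree V

namespace MPQTree

/-- The `i`-th section of a Q-node: the vertices whose first section is not after `i` and whose
last section is not before `i`. -/
def sectionSet {V : Type*} [DecidableEq V] {k : ℕ} (left right : Fin k → List V) (i : Fin k) :
    Finset V :=
  ((Finset.univ.filter fun a => a ≤ i).biUnion fun a => (left a).toFinset) ∩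
    ((Finset.univ.filter fun b => i ≤ b).biUnion fun b => (right b).toFinset)

/-- The frontier: for each leaf, from left to right, the set of all vertices assigned to the
P-nodes and to the sections on the path from the root to this leaf. -/
def frontier {V : Type*} [DecidableEq V] : MPQTree V → List (Finset V)
  | P verts k child =>
      if k = 0 then [verts.toFinset]
      else (List.ofFn fun i => (frontier (child i)).map fun C => verts.toFinset ∪ C).flatten
  | Q _ left right child =>
      (List.ofFn fun i =>
        (frontier (child i)).map fun C => sectionSet left right i ∪ C).flatten

/-- The vertices assigned to the nodes of a tree, where each vertex of a Q-node is listed for its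
first section only. -/
def vertices {V : Type*} : MPQTree V → List V
  | P verts _ child => verts ++ (List.ofFn fun i => vertices (child i)).flatten
  | Q _ left _ child => (List.ofFn fun i => left i ++ vertices (child i)).flatten

/-- Two trees are equivalent if one is obtained from the other by arbitrarily permuting the
subtrees of P-nodes and reversing the order of the sections of Q-nodes. -/
inductive Equivalent {V : Type*} : MPQTree V → MPQTree V → Prop
  | permute (verts : List V) (k : ℕ) (child child' : Fin k → MPQTree V)
      (σ : Equiv.Perm (Fin k)) (h : ∀ i, Equivalent (child (σ i)) (child' i)) :
      Equivalent (P verts k child) (P verts k child')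
  | keep (k : ℕ) (left right : Fin k → List V) (child child' : Fin k → MPQTree V)
      (h : ∀ i, Equivalent (child i) (child' i)) :
      Equivalent (Q k left right child) (Q k left right child')
  | reverse (k : ℕ) (left right : Fin k → List V) (child child' : Fin k → MPQTree V)
      (h : ∀ i, Equivalent (child i.rev) (child' i)) :
      Equivalent (Q k left right child)
        (Q k (fun i => right i.rev) (fun i => left i.rev) child')

/-- The root is a Q-node. -/
def IsQ {V : Type*} : MPQTree V → Prop
  | P _ _ _ => False
  | Q _ _ _ _ => True

/-- The normal form of the nodes. A P-node with only one subtree is nonempty and its subtree is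
rooted at a Q-node. A Q-node has at least three sections, and each of its vertices has exactly one
first and one last section, belongs to at least two sections, and does not belong to all of
them (uniqueness of the first section is part of the requirement on `vertices` in
`Represents`). -/
def IsNormal {V : Type*} : MPQTree V → Prop
  | P verts k child =>
      (k = 1 → verts ≠ [] ∧ ∀ i, IsQ (child i)) ∧ ∀ i, IsNormal (child i)
  | Q k left right child =>
      3 ≤ k ∧
      ((List.ofFn left).flatten).Perm (List.ofFn right).flatten ∧
      (∀ (i j : Fin k) (v : V), v ∈ left i → v ∈ right j →
        i < j ∧ ¬ ((i : ℕ) = 0 ∧ (j : ℕ) + 1 = k)) ∧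
      ∀ i, IsNormal (child i)

/-- `T` is an MPQ-tree of the graph `G`: its nodes are in normal form, each vertex is assigned to
exactly one node, the frontier lists each maximal clique of `G` exactly once with the cliques
containing any vertex consecutive, and each such ordering of the maximal cliques of `G` is the
frontier of some tree equivalent to `T`. -/
structure Represents {V : Type*} [DecidableEq V] (G : SimpleGraph V) (T : MPQTree V) :
    Prop where
  normal : T.IsNormal
  vertices_nodup : T.vertices.Nodup
  mem_vertices : ∀ v, v ∈ T.vertices
  frontier_order : IsConsecutiveCliqueOrder G T.frontier
  complete : ∀ L, IsConsecutiveCliqueOrder G L → ∃ T', Equivalent T T' ∧ T'.frontier = L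

/-- The string representation of a tree. -/
def string {V : Type*} : MPQTree V → List V
  | P verts _ child =>
      verts ++ (List.ofFn fun i => string (child i)).flatten ++ verts.reverse
  | Q _ left right child =>
      (List.ofFn fun i => left i ++ string (child i) ++ right i).flatten

/-- The normalized string representation: the lexicographically smallest of the strings that arise
from the string representation by permuting the labels `1, …, n`; the element `x : Fin n` stands
for the label `x + 1`. -/
def normalizedString {n : ℕ} (T : MPQTree (Fin n)) : List ℕ :=
  Finset.univ.inf' Finset.univ_nonempty
    fun σ : Equiv.Perm (Fin n) => T.string.map fun x => (σ x : ℕ) + 1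

/-- The number of children of the root. -/
def numChildren {V : Type*} : MPQTree V → ℕ
  | P _ k _ => k
  | Q k _ _ _ => k

/-- The number of vertices that belong to the root. -/
def numRootVertices {V : Type*} : MPQTree V → ℕ
  | P verts _ _ => verts.length
  | Q _ left _ _ => ((List.ofFn left).flatten).length

/-- The number of vertices of the tree, the number of vertices of the root and the number of
children of the root, ordered lexicographically. -/
def tuple {V : Type*} (T : MPQTree V) : ℕ ×ₗ ℕ ×ₗ ℕ :=
  toLex (T.vertices.length, toLex (T.numRootVertices, T.numChildren))

/-- The order on trees: first by `tuple`, then lexicographically by normalized strings. -/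
def Precedes {n : ℕ} (T₁ T₂ : MPQTree (Fin n)) : Prop :=
  T₁.tuple < T₂.tuple ∨
    (T₁.tuple = T₂.tuple ∧ T₁.normalizedString ≤ T₂.normalizedString)

/-- `T` is a canonical MPQ-tree of `G`. -/
def IsCanonical {n : ℕ} (G : SimpleGraph (Fin n)) (T : MPQTree (Fin n)) : Prop :=
  T.Represents G ∧ ∀ T' : MPQTree (Fin n), T'.Represents G → T.Precedes T'

end MPQTree

/-- `S` is a canonical string of `G`: the normalized string representation of a canonical
MPQ-tree of `G`. -/
def IsCanonicalString {n : ℕ} (G : SimpleGraph (Fin n)) (S : List ℕ) : Prop :=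
  ∃ T : MPQTree (Fin n), T.IsCanonical G ∧ T.normalizedString = S

/-! Three facts carry the theorem.

Invariance. Relabelling along an isomorphism `G ≃g H` turns MPQ-trees of `G` into MPQ-trees of `H`
(`Represents.map`) and changes neither `tuple` nor the normalized string. Hence canonical trees of
isomorphic graphs precede each other, and trees preceding each other have equal normalized strings
(`IsCanonical.normalizedString_eq`). For the identity isomorphism this is uniqueness of the
canonical string.

Reconstruction. Every vertex occurs exactly twice in the string. Distinct vertices are adjacent iff
some cut of the string leaves an occurrence of both on either side (`Represents.adj_iff`), because
cuts correspond to cliques on the frontier. So the string determines the graph, and equal normalized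
strings give an isomorphism.

Existence. Only finitely many strings are possible, so it suffices that some MPQ-tree exists. By the
Helly property of intervals the maximal cliques have a consecutive ordering, and `exists_isTreeOf`
builds the tree by induction on the number of cliques. Let `U` be the vertices common to all
cliques. If the cliques fall apart after deleting `U`, the root is a P-node whose subtrees are the
components. Otherwise regard each remaining vertex as the set of cliques containing it. Starting
from an inclusion-maximal such set, a component of the overlap graph covers all cliques. Any two
consecutive orderings agree on this component up to one global reversal, because the orientation of
one overlapping pair forces the next (`AgreeOn.trans`). This component becomes a Q-node, placed
under a P-node storing `U` when `U` is nonempty. -/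

namespace MPQTree

/-! ### Relabelling of trees and clique orders -/

variable {V W : Type*}

/-- Relabelling of the vertices of a tree. -/
def map (f : V → W) : MPQTree V → MPQTree W
  | P verts k child => P (verts.map f) k fun i => map f (child i)
  | Q k left right child =>
      Q k (fun i => (left i).map f) (fun i => (right i).map f) fun i => map f (child i)

theorem string_map (f : V → W) (T : MPQTree V) : (T.map f).string = T.string.map f := by
  induction T with
  | P verts k child ih =>
    simp [map, string, List.map_flatten, List.map_ofFn, Function.comp_def, ih]
  | Q k left right child ih =>
    simp [map, string, List.map_flatten, List.map_ofFn, Function.comp_def, ih]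

theorem vertices_map (f : V → W) (T : MPQTree V) : (T.map f).vertices = T.vertices.map f := by
  induction T with
  | P verts k child ih =>
    simp [map, vertices, List.map_flatten, List.map_ofFn, Function.comp_def, ih]
  | Q k left right child ih =>
    simp [map, vertices, List.map_flatten, List.map_ofFn, Function.comp_def, ih]

theorem tuple_map (f : V → W) (T : MPQTree V) : (T.map f).tuple = T.tuple := by
  unfold tuple
  rw [vertices_map]
  cases T <;>
    simp [map, numRootVertices, numChildren, Function.comp_def, List.length_flatten,
      List.map_ofFn]

theorem sectionSet_map [DecidableEq V] [DecidableEq W] {f : V → W} (hf : Function.Injective f)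
    {k : ℕ} (left right : Fin k → List V) (i : Fin k) :
    sectionSet (fun i => (left i).map f) (fun i => (right i).map f) i =
      (sectionSet left right i).image f := by
  unfold sectionSet
  rw [Finset.image_inter _ _ hf]
  ext v
  simp only [Finset.mem_inter, Finset.mem_biUnion, Finset.mem_filter, Finset.mem_image,
    List.mem_toFinset, List.mem_map, Finset.mem_univ, true_and]
  constructor <;> rintro ⟨h1, h2⟩ <;> refine ⟨?_, ?_⟩ <;> clear * - h1 h2 <;> grind

theorem frontier_map [DecidableEq V] [DecidableEq W] {f : V → W} (hf : Function.Injective f)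
    (T : MPQTree V) : (T.map f).frontier = T.frontier.map (Finset.image f) := by
  have key : ∀ A : Finset V, (fun C => A.image f ∪ C) ∘ Finset.image f =
      Finset.image f ∘ fun C => A ∪ C := by
    intro A
    funext C
    simp [Finset.image_union]
  have hl : ∀ l : List V, (l.map f).toFinset = l.toFinset.image f := by
    intro l
    ext
    simp
  induction T with
  | P verts k child ih =>
    by_cases hk : k = 0
    · simp [map, frontier, hk, hl]
    · simp [map, frontier, hk, ih, List.map_flatten, List.map_ofFn, Function.comp_def,
        hl, Finset.image_union]
  | Q k left right child ih =>
    simp [map, frontier, ih, List.map_flatten, List.map_ofFn, Function.comp_def,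
        sectionSet_map hf, Finset.image_union]

theorem isQ_map (f : V → W) (T : MPQTree V) : (T.map f).IsQ ↔ T.IsQ := by
  cases T <;> simp [map, IsQ]

theorem IsNormal.map {f : V → W} (hf : Function.Injective f) {T : MPQTree V}
    (h : T.IsNormal) : (T.map f).IsNormal := by
  induction T with
  | P verts k child ih =>
    simp only [MPQTree.map, IsNormal, isQ_map] at h ⊢
    exact ⟨fun hk => ⟨by simpa using (h.1 hk).1, (h.1 hk).2⟩, fun i => ih i (h.2 i)⟩
  | Q k left right child ih =>
    simp only [MPQTree.map, IsNormal] at h ⊢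
    obtain ⟨h1, h2, h3, h4⟩ := h
    refine ⟨h1, ?_, ?_, fun i => ih i (h4 i)⟩
    · have := h2.map f
      simpa [List.map_flatten, List.map_ofFn, Function.comp_def] using this
    · intro i j v hi hj
      obtain ⟨x, hx, rfl⟩ := List.mem_map.1 hi
      rw [List.mem_map_of_injective hf] at hj
      exact h3 i j x hx hj

theorem Equivalent.map (f : V → W) {T T' : MPQTree V} (h : Equivalent T T') :
    Equivalent (T.map f) (T'.map f) := by
  induction h with
  | permute verts k child child' σ h ih => exact .permute _ _ _ _ σ ih
  | keep k left right child child' h ih => exact .keep _ _ _ _ _ ih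
  | reverse k left right child child' h ih =>
    exact .reverse k (fun i => (left i).map f) (fun i => (right i).map f) _ _ ih

end MPQTree

theorem IsConsecutiveCliqueOrder.map {V W : Type*} [DecidableEq W] {G : SimpleGraph V}
    {H : SimpleGraph W} (φ : G ≃g H) {L : List (Finset V)} (h : IsConsecutiveCliqueOrder G L) :
    IsConsecutiveCliqueOrder H (L.map (Finset.image φ)) := by
  have hinj : Function.Injective φ := φ.injective
  have hcl : ∀ s : Finset V, H.IsClique (s.image φ : Finset W) ↔ G.IsClique (s : Set V) := by
    intro s
    rw [SimpleGraph.isClique_iff, SimpleGraph.isClique_iff, Finset.coe_image,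
      hinj.injOn.pairwise_image]
    simp only [Set.Pairwise, Function.onFun, φ.map_adj_iff]
  have hsurj : ∀ t : Finset W, ∃ s : Finset V, s.image φ = t := by
    intro t
    classical
    refine ⟨t.image φ.symm, ?_⟩
    ext x
    simp
  refine ⟨h.nodup.map (Finset.image_injective hinj), ?_, ?_⟩
  · intro C
    obtain ⟨s, rfl⟩ := hsurj C
    rw [List.mem_map_of_injective (Finset.image_injective hinj), h.mem_iff]
    simp only [Maximal, hcl]
    refine and_congr_right fun _ => ⟨fun hm t ht hle => ?_, fun hm t ht hle => ?_⟩
    · obtain ⟨t, rfl⟩ := hsurj t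
      rw [hcl] at ht
      have := hm ht ((Finset.image_subset_image_iff hinj).1 hle)
      exact Finset.image_subset_image this
    · have := hm ((hcl t).2 ht) (Finset.image_subset_image hle)
      exact (Finset.image_subset_image_iff hinj).1 this
  · intro w i j k hij hjk hi hk
    obtain ⟨v, rfl⟩ := φ.surjective w
    simp only [List.get_eq_getElem, List.getElem_map, Finset.mem_image] at hi hk ⊢
    obtain ⟨x, hx, hxv⟩ := hi
    obtain ⟨y, hy, hyv⟩ := hk
    rw [hinj hxv] at hx
    rw [hinj hyv] at hy
    refine ⟨v, ?_, rfl⟩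
    have hl : (L.map (Finset.image φ)).length = L.length := by simp
    exact h.consecutive v (i.cast hl) (j.cast hl) (k.cast hl) hij hjk hx hy

namespace MPQTree

theorem Represents.map {V W : Type*} [DecidableEq V] [DecidableEq W] {G : SimpleGraph V}
    {H : SimpleGraph W} (φ : G ≃g H) {T : MPQTree V} (h : T.Represents G) :
    (T.map φ).Represents H := by
  have hinj : Function.Injective φ := φ.injective
  refine ⟨h.normal.map hinj, ?_, ?_, ?_, ?_⟩
  · rw [vertices_map]
    exact h.vertices_nodup.map hinj
  · intro v
    rw [vertices_map]
    exact List.mem_map.2 ⟨φ.symm v, h.mem_vertices _, by simp⟩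
  · rw [frontier_map hinj]
    exact h.frontier_order.map φ
  · intro L hL
    obtain ⟨T', hT', hf⟩ := h.complete _ (hL.map φ.symm)
    refine ⟨T'.map φ, hT'.map φ, ?_⟩
    rw [frontier_map hinj, hf, List.map_map]
    refine (List.map_congr_left fun s _ => ?_).trans (List.map_id L)
    simp [Finset.image_image, Function.comp_def]

/-- Relabelling by `τ` only reindexes the minimum over the symmetric group by right multiplication.
-/
theorem normalizedString_map {n : ℕ} (τ : Equiv.Perm (Fin n)) (T : MPQTree (Fin n)) :
    (T.map τ).normalizedString = T.normalizedString := by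
  unfold normalizedString
  apply le_antisymm
  · apply Finset.le_inf'
    intro σ _
    refine (Finset.inf'_le _ (Finset.mem_univ (σ * τ⁻¹))).trans (le_of_eq ?_)
    rw [string_map, List.map_map]
    simp [Function.comp_def]
  · apply Finset.le_inf'
    intro σ _
    refine (Finset.inf'_le _ (Finset.mem_univ (σ * τ))).trans (le_of_eq ?_)
    rw [string_map, List.map_map]
    simp [Function.comp_def]

/-! ### Strings and the existence and invariance of canonical trees -/

theorem exists_normalizedString_eq {n : ℕ} (T : MPQTree (Fin n)) :
    ∃ σ : Equiv.Perm (Fin n), T.normalizedString = T.string.map fun x => (σ x : ℕ) + 1 := by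
  obtain ⟨σ, -, h⟩ := Finset.exists_mem_eq_inf' Finset.univ_nonempty
    (fun σ : Equiv.Perm (Fin n) => T.string.map fun x => (σ x : ℕ) + 1)
  exact ⟨σ, h⟩

theorem count_flatten_ofFn {V : Type*} [DecidableEq V] {k : ℕ} (f : Fin k → List V) (v : V) :
    (List.ofFn f).flatten.count v = ∑ i, (f i).count v := by
  rw [List.count_flatten, List.map_ofFn, List.sum_ofFn]
  rfl

/-- In a P-node the second copy is the reversed list; in a Q-node it comes from `right`, which
normality makes a rearrangement of `left`. -/
theorem string_perm {V : Type*} {T : MPQTree V} (h : T.IsNormal) :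
    T.string.Perm (T.vertices ++ T.vertices) := by
  classical
  rw [List.perm_iff_count]
  intro v
  rw [List.count_append]
  induction T with
  | P verts k child ih =>
    simp only [string, vertices, List.count_append, count_flatten_ofFn, List.count_reverse]
    rw [Finset.sum_congr rfl fun i _ => ih i (h.2 i), Finset.sum_add_distrib]
    ring
  | Q k left right child ih =>
    obtain ⟨-, h2, -, h4⟩ := h
    have h2 := h2.count_eq v
    simp only [count_flatten_ofFn] at h2
    simp only [string, vertices, List.count_append, count_flatten_ofFn, Finset.sum_add_distrib]
    rw [← h2, Finset.sum_congr rfl fun i _ => ih i (h4 i), Finset.sum_add_distrib]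
    ring

theorem mem_string {V : Type*} {T : MPQTree V} (h : T.IsNormal) {v : V} :
    v ∈ T.string ↔ v ∈ T.vertices := by
  rw [(string_perm h).mem_iff]
  simp

theorem Represents.length_string {n : ℕ} {G : SimpleGraph (Fin n)} {T : MPQTree (Fin n)}
    (h : T.Represents G) : T.string.length = 2 * n := by
  have h1 : T.vertices.length = n := by
    have := List.toFinset_card_of_nodup h.vertices_nodup
    rw [← this, Finset.eq_univ_iff_forall.2 fun v => List.mem_toFinset.2 (h.mem_vertices v)]
    simp
  rw [(string_perm h.normal).length_eq, List.length_append, h1]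
  ring

theorem length_normalizedString {n : ℕ} (T : MPQTree (Fin n)) :
    T.normalizedString.length = T.string.length := by
  obtain ⟨σ, h⟩ := exists_normalizedString_eq T
  simp [h]

theorem exists_isCanonical {n : ℕ} {G : SimpleGraph (Fin n)}
    (h : ∃ T : MPQTree (Fin n), T.Represents G) : ∃ T : MPQTree (Fin n), T.IsCanonical G := by
  obtain ⟨T₀, hT₀, hmin⟩ := exists_minimal_of_wellFoundedLT
    (fun t => ∃ T : MPQTree (Fin n), T.Represents G ∧ T.tuple = t) (by
      obtain ⟨T, hT⟩ := h
      exact ⟨_, T, hT, rfl⟩)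
  obtain ⟨T₁, hT₁, rfl⟩ := hT₀
  -- The lexicographic order on `List ℕ` is not well-founded, so the second minimization rests on
  -- finiteness: all strings have length `2 * n` over `Fin n`.
  let A : Set (List ℕ) :=
    normalizedString '' {T : MPQTree (Fin n) | T.Represents G ∧ T.tuple = T₁.tuple}
  have hA : A.Finite := by
    have hfin := List.finite_length_eq (Fin n) (2 * n)
    refine (hfin.biUnion fun l _ => Set.finite_range
      fun σ : Equiv.Perm (Fin n) => l.map fun x => (σ x : ℕ) + 1).subset ?_
    rintro _ ⟨T, hT, rfl⟩
    obtain ⟨σ, hσ⟩ := exists_normalizedString_eq T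
    simp only [Set.mem_iUnion]
    exact ⟨T.string, hT.1.length_string, σ, hσ.symm⟩
  obtain ⟨_, ⟨T, hT, rfl⟩, hTmin⟩ :=
    Set.exists_min_image A id hA ⟨_, T₁, ⟨hT₁, rfl⟩, rfl⟩
  refine ⟨T, hT.1, fun T' hT' => ?_⟩
  rcases lt_trichotomy T.tuple T'.tuple with hlt | heq | hgt
  · exact Or.inl hlt
  · exact Or.inr ⟨heq, hTmin _ ⟨T', ⟨hT', heq ▸ hT.2⟩, rfl⟩⟩
  · rw [hT.2] at hgt
    exact absurd (hmin ⟨T', hT', rfl⟩ hgt.le) (not_le_of_gt hgt)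

theorem normalizedString_eq_of_precedes {n : ℕ} {T T' : MPQTree (Fin n)} (h : T.Precedes T')
    (h' : T'.Precedes T) : T.normalizedString = T'.normalizedString := by
  rcases h with h | ⟨h, h1⟩ <;> rcases h' with h' | ⟨h', h2⟩
  · exact absurd (h.trans h') (lt_irrefl _)
  · exact absurd (h'.symm ▸ h) (lt_irrefl _)
  · exact absurd (h ▸ h') (lt_irrefl _)
  · exact le_antisymm h1 h2

/-- Each canonical tree competes against the relabelled copy of the other, so each precedes the
other. -/
theorem IsCanonical.normalizedString_eq {n : ℕ} {G H : SimpleGraph (Fin n)} (φ : G ≃g H)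
    {T T' : MPQTree (Fin n)} (h : T.IsCanonical G) (h' : T'.IsCanonical H) :
    T.normalizedString = T'.normalizedString := by
  have h1 := h.2 _ (h'.1.map φ.symm)
  have h2 := h'.2 _ (h.1.map φ)
  have e1 := normalizedString_map φ.symm.toEquiv T'
  have e2 := normalizedString_map φ.toEquiv T
  have t1 := tuple_map φ.symm T'
  have t2 := tuple_map φ T
  refine normalizedString_eq_of_precedes ?_ ?_
  · unfold Precedes at h1 ⊢
    rw [t1] at h1
    rwa [show (T'.map φ.symm).normalizedString = _ from e1] at h1
  · unfold Precedes at h2 ⊢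
    rw [t2] at h2
    rwa [show (T.map φ).normalizedString = _ from e2] at h2

/-! ### Cuts of the string and cliques of the frontier -/

theorem flatten_ofFn_eq_append {V : Type*} {k : ℕ} (hk : k ≠ 0) {f : Fin k → List V}
    {a b : List V} (h : (List.ofFn f).flatten = a ++ b) :
    ∃ i a' b', f i = a' ++ b' ∧ (∀ v ∈ a, v ∈ a' ∨ ∃ j < i, v ∈ f j) ∧
      ∀ v ∈ b, v ∈ b' ∨ ∃ j > i, v ∈ f j := by
  induction k generalizing a b with
  | zero => exact absurd rfl hk
  | succ k ih =>
    rw [List.ofFn_succ, List.flatten_cons, List.append_eq_append_iff] at h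
    have hbase : ∀ c, f 0 = a ++ c → b = c ++ (List.ofFn fun i => f i.succ).flatten →
        ∃ i a' b', f i = a' ++ b' ∧ (∀ v ∈ a, v ∈ a' ∨ ∃ j < i, v ∈ f j) ∧
        ∀ v ∈ b, v ∈ b' ∨ ∃ j > i, v ∈ f j := by
      intro c hc hb
      refine ⟨0, a, c, hc, fun v hv => Or.inl hv, fun v hv => ?_⟩
      rw [hb, List.mem_append, List.mem_flatten] at hv
      rcases hv with hv | ⟨l, hl, hv⟩
      · exact Or.inl hv
      · obtain ⟨j, rfl⟩ := List.mem_ofFn.1 hl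
        exact Or.inr ⟨j.succ, Fin.succ_pos j, hv⟩
    rcases h with ⟨c, ha, hc⟩ | ⟨c, h0, hb⟩
    · by_cases hk0 : k = 0
      · subst hk0
        simp only [List.ofFn_zero, List.flatten_nil, List.nil_eq, List.append_eq_nil_iff] at hc
        obtain ⟨rfl, rfl⟩ := hc
        exact hbase [] (by simpa using ha.symm) (by simp)
      · obtain ⟨i, a', b', hi, h1, h2⟩ := ih hk0 hc
        refine ⟨i.succ, a', b', hi, fun v hv => ?_, fun v hv => ?_⟩
        · rw [ha, List.mem_append] at hv
          rcases hv with hv | hv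
          · exact Or.inr ⟨0, Fin.succ_pos i, hv⟩
          · rcases h1 v hv with hv | ⟨j, hj, hv⟩
            · exact Or.inl hv
            · exact Or.inr ⟨j.succ, Fin.succ_lt_succ_iff.2 hj, hv⟩
        · rcases h2 v hv with hv | ⟨j, hj, hv⟩
          · exact Or.inl hv
          · exact Or.inr ⟨j.succ, Fin.succ_lt_succ_iff.2 hj, hv⟩
    · exact hbase c h0 hb

theorem exists_flatten_ofFn_eq_append {V : Type*} {k : ℕ} {f : Fin k → List V} {i : Fin k}
    {a' b' : List V} (h : f i = a' ++ b') :
    ∃ a b, (List.ofFn f).flatten = a ++ b ∧ a' ⊆ a ∧ (∀ j < i, f j ⊆ a) ∧ b' ⊆ b ∧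
      ∀ j > i, f j ⊆ b := by
  induction k with
  | zero => exact i.elim0
  | succ k ih =>
    rw [List.ofFn_succ, List.flatten_cons]
    induction i using Fin.cases with
    | zero =>
      refine ⟨a', b' ++ (List.ofFn fun i => f i.succ).flatten, by simp [h],
        List.Subset.refl _, fun j hj => absurd hj (Fin.not_lt_zero j),
        List.subset_append_left _ _, fun j hj => ?_⟩
      obtain ⟨j, rfl⟩ := Fin.exists_succ_eq.2 hj.ne'
      exact fun v hv => List.mem_append_right _
        (List.mem_flatten.2 ⟨_, List.mem_ofFn.2 ⟨j, rfl⟩, hv⟩)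
    | succ i =>
      obtain ⟨a, b, hab, h1, h2, h3, h4⟩ := ih (f := fun i => f i.succ) h
      refine ⟨f 0 ++ a, b, by simp [hab], fun v hv => List.mem_append_right _ (h1 hv),
        fun j hj => ?_, h3, fun j hj => ?_⟩
      · induction j using Fin.cases with
        | zero => exact List.subset_append_left _ _
        | succ j => exact fun v hv =>
            List.mem_append_right _ (h2 j (Fin.succ_lt_succ_iff.1 hj) hv)
      · induction j using Fin.cases with
        | zero => exact absurd hj (Fin.not_lt_zero _)
        | succ j => exact h4 j (Fin.succ_lt_succ_iff.1 hj)

/-- A cut inside `l` or `r` is moved to the nearer end of `s`. The vertices of `l` and `r` are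
allowed on both sides, since a node's own vertices are treated separately. -/
theorem middle_eq_append {V : Type*} {l s r a b : List V} (h : l ++ s ++ r = a ++ b) :
    ∃ a' b', s = a' ++ b' ∧ (∀ v ∈ a, v ∈ l ∨ v ∈ a' ∨ v ∈ r) ∧
      ∀ v ∈ b, v ∈ l ∨ v ∈ b' ∨ v ∈ r := by
  rcases List.append_eq_append_iff.1 h with ⟨c, rfl, rfl⟩ | ⟨c, h1, rfl⟩
  · exact ⟨s, [], by simp, by simp; tauto, by simp; tauto⟩
  · rcases List.append_eq_append_iff.1 h1 with ⟨d, rfl, rfl⟩ | ⟨d, rfl, rfl⟩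
    · exact ⟨d, c, rfl, by simp; tauto, by simp; tauto⟩
    · exact ⟨[], s, by simp, by simp; tauto, by simp; tauto⟩

section Frontier

variable {V : Type*} [DecidableEq V]

theorem mem_sectionSet {k : ℕ} {left right : Fin k → List V} {i : Fin k} {v : V} :
    v ∈ sectionSet left right i ↔ (∃ a ≤ i, v ∈ left a) ∧ ∃ b ≥ i, v ∈ right b := by
  simp [sectionSet]

theorem mem_frontier_P {verts : List V} {k : ℕ} (hk : k ≠ 0) {child : Fin k → MPQTree V}
    {C : Finset V} : C ∈ (P verts k child).frontier ↔
      ∃ i, ∃ D ∈ (child i).frontier, C = verts.toFinset ∪ D := by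
  simp [frontier, hk, List.mem_flatten, List.mem_ofFn, eq_comm]

theorem mem_frontier_Q {k : ℕ} {left right : Fin k → List V} {child : Fin k → MPQTree V}
    {C : Finset V} : C ∈ (Q k left right child).frontier ↔
      ∃ i, ∃ D ∈ (child i).frontier, C = sectionSet left right i ∪ D := by
  simp [frontier, List.mem_flatten, List.mem_ofFn, eq_comm]

/-- The cut is made in the leaf that produces `C`. Each node on the path then writes its
contributing vertices once before and once after the part containing the cut. -/
theorem exists_string_eq_append {T : MPQTree V} (hT : T.IsNormal) {C : Finset V}
    (hC : C ∈ T.frontier) :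
    ∃ a b, T.string = a ++ b ∧ ∀ v ∈ C, v ∈ a ∧ v ∈ b := by
  induction T generalizing C with
  | P verts k child ih =>
    by_cases hk : k = 0
    · subst hk
      simp only [frontier, if_true, List.mem_singleton] at hC
      subst hC
      exact ⟨verts, verts.reverse, by simp [string], by simp⟩
    · obtain ⟨i, D, hD, rfl⟩ := (mem_frontier_P hk).1 hC
      obtain ⟨a, b, hab, hv⟩ := ih i (hT.2 i) hD
      obtain ⟨a', b', hab', h1, -, h2, -⟩ :=
        exists_flatten_ofFn_eq_append (f := fun i => (child i).string) hab
      refine ⟨verts ++ a', b' ++ verts.reverse, by simp [string, hab'], ?_⟩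
      intro v
      simp only [Finset.mem_union, List.mem_toFinset, List.mem_append, List.mem_reverse]
      rintro (h | h)
      · exact ⟨Or.inl h, Or.inr h⟩
      · exact ⟨Or.inr (h1 (hv v h).1), Or.inl (h2 (hv v h).2)⟩
  | Q k left right child ih =>
    obtain ⟨i, D, hD, rfl⟩ := mem_frontier_Q.1 hC
    obtain ⟨a, b, hab, hv⟩ := ih i (hT.2.2.2 i) hD
    obtain ⟨a', b', hab', h1, h2, h3, h4⟩ :=
      exists_flatten_ofFn_eq_append (f := fun i => left i ++ (child i).string ++ right i)
        (i := i) (a' := left i ++ a) (b' := b ++ right i) (by simp [hab])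
    refine ⟨a', b', by simpa [string] using hab', ?_⟩
    intro v
    rw [Finset.mem_union, mem_sectionSet]
    rintro (⟨⟨p, hp, hvp⟩, ⟨q, hq, hvq⟩⟩ | h)
    · constructor
      · rcases hp.lt_or_eq with hp | rfl
        · exact h2 p hp (by simp [hvp])
        · exact h1 (by simp [hvp])
      · rcases hq.lt_or_eq with hq | rfl
        · exact h4 q hq (by simp [hvq])
        · exact h3 (by simp [hvq])
    · exact ⟨h1 (by simp [hv v h]), h3 (by simp [hv v h])⟩

theorem eq_of_mem_of_nodup_flatten_ofFn {W : Type*} {k : ℕ} {f : Fin k → List W}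
    (h : (List.ofFn f).flatten.Nodup) {v : W} {i j : Fin k} (hi : v ∈ f i) (hj : v ∈ f j) :
    i = j := by
  rw [List.nodup_flatten, List.pairwise_ofFn] at h
  by_contra hne
  rcases lt_or_gt_of_ne hne with hlt | hlt
  · exact h.2 hlt hi hj
  · exact h.2 hlt hj hi

theorem nodup_of_nodup_flatten_ofFn {W : Type*} {k : ℕ} {f : Fin k → List W}
    (h : (List.ofFn f).flatten.Nodup) (i : Fin k) : (f i).Nodup :=
  (List.nodup_flatten.1 h).1 _ (List.mem_ofFn.2 ⟨i, rfl⟩)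

/-- The cut is followed down the tree to a leaf. A vertex with occurrences on both sides either
belongs to the current node or lies in the subtree being cut, since different subtrees have disjoint
vertices. Only an inclusion is obtained, which is enough to prove adjacency. -/
theorem exists_mem_frontier_of_string_eq_append {T : MPQTree V} (hT : T.IsNormal)
    (hnd : T.vertices.Nodup) {a b : List V} (h : T.string = a ++ b) :
    ∃ C ∈ T.frontier, ∀ v, v ∈ a → v ∈ b → v ∈ C := by
  induction T generalizing a b with
  | P verts k child ih =>
    simp only [string] at h
    obtain ⟨a', b', hs, ha, hb⟩ := middle_eq_append h
    by_cases hk : k = 0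
    · subst hk
      refine ⟨verts.toFinset, by simp [frontier], fun v hva hvb => ?_⟩
      simp only [List.ofFn_zero, List.flatten_nil, List.nil_eq, List.append_eq_nil_iff] at hs
      have := ha v hva
      simp [hs] at this
      simpa using this
    · obtain ⟨i, a'', b'', hi, h1, h2⟩ := flatten_ofFn_eq_append hk hs
      simp only [vertices] at hnd
      have hnd' := (List.nodup_append.1 hnd).2.1
      obtain ⟨D, hD, hDv⟩ := ih i (hT.2 i) (nodup_of_nodup_flatten_ofFn hnd' i) hi
      refine ⟨verts.toFinset ∪ D, (mem_frontier_P hk).2 ⟨i, D, hD, rfl⟩, fun v hva hvb => ?_⟩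
      rw [Finset.mem_union, List.mem_toFinset]
      by_cases hv : v ∈ verts
      · exact Or.inl hv
      right
      have hva' : v ∈ a' := by simpa [hv] using ha v hva
      have hvb' : v ∈ b' := by simpa [hv] using hb v hvb
      have huniq : ∀ i j, v ∈ (child i).string → v ∈ (child j).string → i = j := by
        intro i j h1 h2
        rw [mem_string (hT.2 _)] at h1 h2
        exact eq_of_mem_of_nodup_flatten_ofFn hnd' h1 h2
      have hai : v ∈ a'' → v ∈ (child i).string := fun h => by rw [hi]; simp [h]
      have hbi : v ∈ b'' → v ∈ (child i).string := fun h => by rw [hi]; simp [h]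
      rcases h1 v hva' with h1 | ⟨j, hj, h1⟩ <;> rcases h2 v hvb' with h2 | ⟨j', hj', h2⟩
      · exact hDv v h1 h2
      · exact absurd (huniq _ _ (hai h1) h2) (ne_of_lt hj')
      · exact absurd (huniq _ _ (hbi h2) h1) (ne_of_gt hj)
      · exact absurd (huniq _ _ h1 h2) (ne_of_lt (hj.trans hj'))
  | Q k left right child ih =>
    obtain ⟨hk, hperm, hlr, hch⟩ := hT
    simp only [string] at h
    obtain ⟨i, a', b', hi, ha, hb⟩ := flatten_ofFn_eq_append (by omega) h
    obtain ⟨a'', b'', hs, ha', hb'⟩ := middle_eq_append hi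
    simp only [vertices] at hnd
    obtain ⟨D, hD, hDv⟩ := ih i (hch i)
      (List.nodup_append.1 (nodup_of_nodup_flatten_ofFn hnd i)).2.1 hs
    refine ⟨_, mem_frontier_Q.2 ⟨i, D, hD, rfl⟩, fun v hva hvb => ?_⟩
    rw [Finset.mem_union, mem_sectionSet]
    have hleft : ∀ q, v ∈ right q → ∃ p, v ∈ left p := by
      intro q hq
      have : v ∈ (List.ofFn left).flatten :=
        hperm.mem_iff.2 (List.mem_flatten.2 ⟨_, List.mem_ofFn.2 ⟨q, rfl⟩, hq⟩)
      obtain ⟨_, hl, hv⟩ := List.mem_flatten.1 this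
      obtain ⟨p, rfl⟩ := List.mem_ofFn.1 hl
      exact ⟨p, hv⟩
    have hright : ∀ p, v ∈ left p → ∃ q, v ∈ right q := by
      intro q hq
      have : v ∈ (List.ofFn right).flatten :=
        hperm.mem_iff.1 (List.mem_flatten.2 ⟨_, List.mem_ofFn.2 ⟨q, rfl⟩, hq⟩)
      obtain ⟨_, hl, hv⟩ := List.mem_flatten.1 this
      obtain ⟨p, rfl⟩ := List.mem_ofFn.1 hl
      exact ⟨p, hv⟩
    by_cases hnode : ∃ p, v ∈ left p
    · obtain ⟨p, hp⟩ := hnode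
      obtain ⟨q, hq⟩ := hright p hp
      have hpu : ∀ p', v ∈ left p' → p' = p := fun p' hp' =>
        eq_of_mem_of_nodup_flatten_ofFn (v := v) hnd (by simp [hp']) (by simp [hp])
      have hch' : ∀ j, v ∉ (child j).string := by
        intro j hj
        rw [mem_string (hch j)] at hj
        have := eq_of_mem_of_nodup_flatten_ofFn hnd (v := v) (i := j) (j := p)
          (by simp [hj]) (by simp [hp])
        subst this
        exact (List.nodup_append.1 (nodup_of_nodup_flatten_ofFn hnd j)).2.2 v hp v hj rfl
      left
      have hlt : ∀ q', v ∈ right q' → p < q' := fun q' hq' => (hlr p q' v hp hq').1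
      refine ⟨⟨p, ?_, hp⟩, ?_⟩
      · have : ∃ j ≤ i, v ∈ left j ++ (child j).string ++ right j := by
          rcases ha v hva with h1 | ⟨j, hj, h1⟩
          · exact ⟨i, le_rfl, by rw [hi]; simp [h1]⟩
          · exact ⟨j, hj.le, h1⟩
        obtain ⟨j, hj, h1⟩ := this
        simp only [List.mem_append, hch' j, or_false] at h1
        rcases h1 with h1 | h1
        · exact hpu j h1 ▸ hj
        · exact (hlt j h1).le.trans hj
      · have : ∃ j ≥ i, v ∈ left j ++ (child j).string ++ right j := by
          rcases hb v hvb with h1 | ⟨j, hj, h1⟩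
          · exact ⟨i, le_rfl, by rw [hi]; simp [h1]⟩
          · exact ⟨j, hj.le, h1⟩
        obtain ⟨j, hj, h1⟩ := this
        -- The occurrence after the cut may be the first one. Then its section is `p`, and `p < q`
        -- still places the last section beyond `i`.
        simp only [List.mem_append, hch' j, or_false] at h1
        rcases h1 with h1 | h1
        · exact ⟨q, hj.trans (hpu j h1 ▸ (hlt q hq).le), hq⟩
        · exact ⟨j, hj, h1⟩
    · right
      have hl : ∀ j, v ∉ left j := fun j hj => hnode ⟨j, hj⟩
      have hr : ∀ j, v ∉ right j := fun j hj => hnode (hleft j hj)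
      have huniq : ∀ i j, v ∈ (child i).string → v ∈ (child j).string → i = j := by
        intro i j h1 h2
        rw [mem_string (hch _)] at h1 h2
        exact eq_of_mem_of_nodup_flatten_ofFn (v := v) hnd (by simp [h1]) (by simp [h2])
      simp only [List.mem_append] at ha hb
      have hai : v ∈ a'' → v ∈ (child i).string := fun h => by rw [hs]; simp [h]
      have hbi : v ∈ b'' → v ∈ (child i).string := fun h => by rw [hs]; simp [h]
      have ha'' := ha' v
      have hb'' := hb' v
      simp only [hl, hr, or_false, false_or] at ha'' hb''
      have h1 := ha v hva
      have h2 := hb v hvb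
      simp only [hl, hr, or_false, false_or] at h1 h2
      rcases h1 with h1 | ⟨j, hj, h1⟩ <;> rcases h2 with h2 | ⟨j', hj', h2⟩
      · exact hDv v (ha'' h1) (hb'' h2)
      · exact absurd (huniq _ _ (hai (ha'' h1)) h2) (ne_of_lt hj')
      · exact absurd (huniq _ _ (hbi (hb'' h2)) h1) (ne_of_gt hj)
      · exact absurd (huniq _ _ h1 h2) (ne_of_lt (hj.trans hj'))

end Frontier

theorem exists_maximal_isClique {V : Type*} [Finite V] (G : SimpleGraph V) {s : Finset V}
    (hs : G.IsClique (s : Set V)) :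
    ∃ C, s ⊆ C ∧ Maximal (fun s : Finset V => G.IsClique (s : Set V)) C := by
  have := Fintype.ofFinite V
  exact (Set.toFinite {s : Finset V | G.IsClique (s : Set V)}).exists_le_maximal hs

theorem Represents.adj_iff {V : Type*} [Finite V] [DecidableEq V] {G : SimpleGraph V}
    {T : MPQTree V} (h : T.Represents G) {u v : V} :
    G.Adj u v ↔ u ≠ v ∧ ∃ a b, T.string = a ++ b ∧ (u ∈ a ∧ u ∈ b) ∧ (v ∈ a ∧ v ∈ b) := by
  constructor
  · intro huv
    refine ⟨huv.ne, ?_⟩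
    obtain ⟨C, hsC, hC⟩ := exists_maximal_isClique G (s := {u, v}) (by
      simp [huv])
    obtain ⟨a, b, hab, hv⟩ :=
      exists_string_eq_append h.normal ((h.frontier_order.mem_iff C).2 hC)
    exact ⟨a, b, hab, hv u (hsC (by simp)), hv v (hsC (by simp))⟩
  · rintro ⟨hne, a, b, hab, hu, hv⟩
    obtain ⟨C, hC, hCv⟩ :=
      exists_mem_frontier_of_string_eq_append h.normal h.vertices_nodup hab
    exact ((h.frontier_order.mem_iff C).1 hC).1 (hCv u hu.1 hu.2) (hCv v hv.1 hv.2) hne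

theorem Represents.nonempty_iso {n m : ℕ} {G₁ : SimpleGraph (Fin n)} {G₂ : SimpleGraph (Fin m)}
    {T₁ : MPQTree (Fin n)} {T₂ : MPQTree (Fin m)} (h₁ : T₁.Represents G₁)
    (h₂ : T₂.Represents G₂) (h : T₁.normalizedString = T₂.normalizedString) :
    Nonempty (G₁ ≃g G₂) := by
  have hlen := congrArg List.length h
  rw [length_normalizedString, length_normalizedString, h₁.length_string,
    h₂.length_string] at hlen
  obtain rfl : n = m := by omega
  obtain ⟨σ, hσ⟩ := exists_normalizedString_eq T₁
  obtain ⟨τ, hτ⟩ := exists_normalizedString_eq T₂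
  rw [hσ, hτ] at h
  have h' : T₁.string.map σ = T₂.string.map τ := by
    have hinj : Function.Injective fun x : Fin n => (x : ℕ) + 1 := by
      intro x y hxy
      exact Fin.ext (Nat.succ_injective hxy)
    apply hinj.list_map
    simpa [List.map_map, Function.comp_def] using h
  let φ : Equiv.Perm (Fin n) := σ.trans τ.symm
  have hφ : T₂.string = T₁.string.map φ := by
    have := congrArg (List.map τ.symm) h'
    rw [List.map_map, List.map_map] at this
    simpa [φ, Function.comp_def] using this.symm
  have mem_map : ∀ (l : List (Fin n)) x, φ x ∈ l.map φ ↔ x ∈ l :=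
    fun l x => List.mem_map_of_injective φ.injective
  refine ⟨⟨φ, fun {u v} => ?_⟩⟩
  rw [h₁.adj_iff, h₂.adj_iff, hφ]
  simp only [ne_eq, φ.injective.eq_iff]
  refine and_congr_right fun _ => ⟨?_, ?_⟩
  · rintro ⟨a, b, hab, hu, hv⟩
    obtain ⟨a', b', hab', rfl, rfl⟩ := List.map_eq_append_iff.1 hab
    rw [mem_map, mem_map] at hu hv
    exact ⟨a', b', hab', hu, hv⟩
  · rintro ⟨a, b, hab, hu, hv⟩
    refine ⟨a.map φ, b.map φ, by rw [hab, List.map_append], ?_⟩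
    rw [mem_map, mem_map, mem_map, mem_map]
    exact ⟨hu, hv⟩

end MPQTree

/-! ### Consecutive clique orders of interval graphs -/

theorem IsIntervalGraph.exists_isConsecutiveCliqueOrder {V : Type*} [Finite V]
    {G : SimpleGraph V} (hG : IsIntervalGraph G) : ∃ L, IsConsecutiveCliqueOrder G L := by
  classical
  have := Fintype.ofFinite V
  obtain ⟨a, b, hab, hG⟩ := hG
  have hpt : ∀ C : Finset V, ∃ x, G.IsClique (C : Set V) → ∀ v ∈ C, a v ≤ x ∧ x ≤ b v := by
    intro C
    rcases C.eq_empty_or_nonempty with rfl | hne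
    · exact ⟨0, by simp⟩
    -- Helly in dimension one: the largest left endpoint in a clique lies in all of its intervals.
    -- Sorting by these points works because a maximal clique contains every vertex whose interval
    -- contains its point.
    · refine ⟨C.sup' hne a, fun hC v hv => ⟨Finset.le_sup' a hv, Finset.sup'_le _ _ ?_⟩⟩
      intro u hu
      by_cases huv : u = v
      · exact huv ▸ hab u
      · obtain ⟨y, hy⟩ := (hG u v huv).1 (hC hu hv huv)
        exact hy.1.1.trans hy.2.2
  choose x hx using hpt
  have hmax : ∀ C, Maximal (fun s : Finset V => G.IsClique (s : Set V)) C →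
      ∀ v, (∃ y, a v ≤ y ∧ y ≤ b v ∧ ∀ u ∈ C, a u ≤ y ∧ y ≤ b u) → v ∈ C := by
    rintro C hC v ⟨y, hvy, hyv, hy⟩
    have hcl : G.IsClique (insert v C : Finset V) := by
      rw [Finset.coe_insert, SimpleGraph.isClique_insert]
      exact ⟨hC.1, fun u hu hvu =>
        (hG v u hvu).2 ⟨y, ⟨hvy, hyv⟩, hy u hu⟩⟩
    exact hC.2 hcl (Finset.subset_insert v C) (Finset.mem_insert_self v C)
  let S : Finset (Finset V) :=
    Finset.univ.filter (Maximal fun s : Finset V => G.IsClique (s : Set V))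
  have hS : ∀ C, C ∈ S ↔ Maximal (fun s : Finset V => G.IsClique (s : Set V)) C := by
    simp [S]
  let le : Finset V → Finset V → Bool := fun C D => decide (x C ≤ x D)
  have hsort := List.pairwise_mergeSort (le := le)
    (fun A B C h1 h2 => by simp only [le, decide_eq_true_eq] at *; exact h1.trans h2)
    (fun A B => by simp only [le, Bool.or_eq_true, decide_eq_true_eq]; exact le_total _ _)
    S.toList
  have hperm := List.mergeSort_perm S.toList le
  refine ⟨S.toList.mergeSort le, hperm.nodup_iff.2 S.nodup_toList, fun C => ?_, ?_⟩
  · rw [hperm.mem_iff, Finset.mem_toList, hS]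
  · have hmono : ∀ i j : Fin (S.toList.mergeSort le).length, i ≤ j →
        x ((S.toList.mergeSort le).get i) ≤ x ((S.toList.mergeSort le).get j) := by
      intro i j hij
      rcases hij.lt_or_eq with hlt | rfl
      · simpa [le] using List.pairwise_iff_get.1 hsort i j hlt
      · exact le_rfl
    have hmem : ∀ i : Fin (S.toList.mergeSort le).length,
        Maximal (fun s : Finset V => G.IsClique (s : Set V))
          ((S.toList.mergeSort le).get i) := by
      intro i
      rw [← hS, ← Finset.mem_toList, ← hperm.mem_iff]
      exact List.get_mem _ _
    intro v i j k hij hjk hi hk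
    refine hmax _ (hmem j) v ⟨x ((S.toList.mergeSort le).get j), ?_, ?_, hx _ (hmem j).1⟩
    · exact (hx _ (hmem i).1 v hi).1.trans (hmono i j hij)
    · exact (hmono j k hjk).trans (hx _ (hmem k).1 v hk).2

/-! ### Orientation of overlapping convex sets -/

/-- `A` is convex with respect to the positions `p`. -/
def ConvexPos {X : Type*} (p : X → ℤ) (A : Set X) : Prop :=
  ∀ a b c, a ∈ A → c ∈ A → p a ≤ p b → p b ≤ p c → b ∈ A

/-- Two sets overlap if they intersect and neither contains the other. -/
def Overlap {X : Type*} (A B : Set X) : Prop :=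
  (A ∩ B).Nonempty ∧ (A \ B).Nonempty ∧ (B \ A).Nonempty

theorem Overlap.symm {X : Type*} {A B : Set X} (h : Overlap A B) : Overlap B A :=
  ⟨Set.inter_comm A B ▸ h.1, h.2.2, h.2.1⟩

theorem subset_or_subset_of_not_overlap {X : Type*} {A B : Set X} (h : ¬ Overlap A B)
    (hAB : (A ∩ B).Nonempty) : A ⊆ B ∨ B ⊆ A := by
  by_contra! hne
  exact h ⟨hAB, Set.sdiff_nonempty.2 hne.1, Set.sdiff_nonempty.2 hne.2⟩

theorem ConvexPos.neg {X : Type*} {p : X → ℤ} {A : Set X} (h : ConvexPos p A) :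
    ConvexPos (fun x => -p x) A :=
  fun a b c ha hc hab hbc => h c b a hc ha (by simpa using hbc) (by simpa using hab)

section Sign

variable {X : Type*} {p q : X → ℤ} {A B C : Set X}

/-- The positions `p` and `q` order the differences of `A` and `B` in the same way. -/
def AgreeOn (p q : X → ℤ) (A B : Set X) : Prop :=
  ∀ x ∈ A \ B, ∀ y ∈ B \ A, (p x < p y ↔ q x < q y)

theorem between_of_lt (hA : ConvexPos p A) (hB : ConvexPos p B)
    {x y m : X} (hx : x ∈ A \ B) (hy : y ∈ B \ A) (hm : m ∈ A ∩ B) (h : p x < p y) :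
    p x < p m ∧ p m < p y := by
  constructor
  · by_contra! hlt
    exact hx.2 (hB m x y hm.2 hy.1 hlt h.le)
  · by_contra! hlt
    exact hy.2 (hA x y m hx.1 hm.1 h.le hlt)

/-- The intersection lies between the two differences, so one comparison fixes all of them: an
overlapping pair has a single orientation. -/
theorem lt_of_lt_of_overlap (hA : ConvexPos p A) (hB : ConvexPos p B) {x y x' y' : X}
    (hAB : Overlap A B) (hx : x ∈ A \ B) (hy : y ∈ B \ A) (hx' : x' ∈ A \ B)
    (hy' : y' ∈ B \ A) (h : p x < p y) : p x' < p y' := by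
  obtain ⟨m, hm⟩ := hAB.1
  obtain ⟨h1, h2⟩ := between_of_lt hA hB hx hy hm h
  have h3 : p x' < p m := by
    by_contra! hlt
    rcases le_total (p x') (p y) with h3 | h3
    · exact hx'.2 (hB m x' y hm.2 hy.1 hlt h3)
    · exact hy.2 (hA m y x' hm.1 hx'.1 h2.le h3)
  have h4 : p m < p y' := by
    by_contra! hlt
    rcases le_total (p x) (p y') with h4 | h4
    · exact hy'.2 (hA x y' m hx.1 hm.1 h4 hlt)
    · exact hx.2 (hB y' x m hy'.1 hm.2 h4 h1.le)
  exact h3.trans h4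

theorem AgreeOn.symm (hp : Function.Injective p) (hq : Function.Injective q)
    (h : AgreeOn p q A B) : AgreeOn p q B A := by
  intro x hx y hy
  have hne : x ≠ y := fun e => hx.2 (e ▸ hy.1)
  have h1 := h y hy x hx
  have h2 := hp.ne hne
  have h3 := hq.ne hne
  omega

theorem agreeOn_or_agreeOn_neg (hp : Function.Injective p) (hq : Function.Injective q)
    (hpA : ConvexPos p A) (hpB : ConvexPos p B) (hqA : ConvexPos q A) (hqB : ConvexPos q B)
    (hAB : Overlap A B) : AgreeOn p q A B ∨ AgreeOn p (fun x => -q x) A B := by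
  obtain ⟨x, hx⟩ := hAB.2.1
  obtain ⟨y, hy⟩ := hAB.2.2
  have hne : ∀ x ∈ A \ B, ∀ y ∈ B \ A, p x ≠ p y ∧ q x ≠ q y := fun x hx y hy =>
    have hne : x ≠ y := fun e => hx.2 (e ▸ hy.1)
    ⟨hp.ne hne, hq.ne hne⟩
  have key : ∀ x' ∈ A \ B, ∀ y' ∈ B \ A, (p x < p y ↔ p x' < p y') ∧
      (q x < q y ↔ q x' < q y') := fun x' hx' y' hy' =>
    ⟨⟨lt_of_lt_of_overlap hpA hpB hAB hx hy hx' hy', lt_of_lt_of_overlap hpA hpB hAB hx' hy' hx hy⟩,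
      ⟨lt_of_lt_of_overlap hqA hqB hAB hx hy hx' hy',
        lt_of_lt_of_overlap hqA hqB hAB hx' hy' hx hy⟩⟩
  by_cases h : p x < p y ↔ q x < q y
  · left
    intro x' hx' y' hy'
    have := key x' hx' y' hy'
    tauto
  · right
    intro x' hx' y' hy'
    have h1 := key x' hx' y' hy'
    have h2 := hne x' hx' y' hy'
    have h3 := hne x hx y hy
    change p x' < p y' ↔ -q x' < -q y'
    omega

/-- In `p` both `A` and `C` stick out of `B` on the same side, so their traces on `B` are nested. In
`q` they stick out on opposite sides and share a point `t`, so `w` falls into `A` and `y` into `C`,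
which contradicts nestedness. -/
theorem false_of_lt_of_lt (hpA : ConvexPos p A) (hpB : ConvexPos p B) (hpC : ConvexPos p C)
    (hqA : ConvexPos q A) (hqB : ConvexPos q B) (hqC : ConvexPos q C)
    (hAB : (A ∩ B).Nonempty) (hCB : (C ∩ B).Nonempty) {x y z w : X} (hx : x ∈ A \ B)
    (hy : y ∈ B \ A) (hz : z ∈ C \ B) (hw : w ∈ B \ C) (h1 : p x < p y) (h2 : p z < p w)
    (h3 : q x < q y) (h4 : q w < q z) : False := by
  obtain ⟨t, htA, htB, htC⟩ : ∃ t, t ∈ A ∧ t ∈ B ∧ t ∈ C := by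
    obtain ⟨m, hm⟩ := hAB
    obtain ⟨n, hn⟩ := hCB
    have h5 := between_of_lt hpA hpB hx hy hm h1
    have h6 := between_of_lt hpC hpB hz hw hn h2
    rcases le_total (p m) (p n) with h | h
    · refine ⟨m, hm.1, hm.2, hpC z m n hz.1 hn.1 ?_ h⟩
      by_contra! hlt
      exact hz.2 (hpB m z n hm.2 hn.2 hlt.le h6.1.le)
    · refine ⟨n, hpA x n m hx.1 hm.1 ?_ h, hn.2, hn.1⟩
      by_contra! hlt
      exact hx.2 (hpB n x m hn.2 hm.2 hlt.le h5.1.le)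
  have h5 := between_of_lt hpA hpB hx hy ⟨htA, htB⟩ h1
  have h6 := between_of_lt hpC hpB hz hw ⟨htC, htB⟩ h2
  have h7 := between_of_lt hqA hqB hx hy ⟨htA, htB⟩ h3
  have h8 := between_of_lt hqB hqC hw hz ⟨htB, htC⟩ h4
  have hwA : w ∈ A := by
    refine hqA x w t hx.1 htA ?_ h8.1.le
    by_contra! hlt
    exact hx.2 (hqB w x t hw.1 htB hlt.le h7.1.le)
  have hyC : y ∈ C := by
    refine hqC t y z htC hz.1 h7.2.le ?_
    by_contra! hlt
    exact hz.2 (hqB t z y htB hy.1 h8.2.le hlt.le)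
  rcases le_total (p y) (p w) with h | h
  · exact hy.2 (hpA t y w htA hwA h5.2.le h)
  · exact hw.2 (hpC t w y htC hyC h6.2.le h)

/-- If the orientations agreed on `A, B` but not on `B, C`, then `false_of_lt_of_lt` would apply
after possibly exchanging `p` and `q` or reversing both orders. -/
theorem AgreeOn.trans (hp : Function.Injective p) (hq : Function.Injective q)
    (hpA : ConvexPos p A) (hpB : ConvexPos p B) (hpC : ConvexPos p C)
    (hqA : ConvexPos q A) (hqB : ConvexPos q B) (hqC : ConvexPos q C)
    (hAB : Overlap A B) (hBC : Overlap B C) (h : AgreeOn p q A B) : AgreeOn p q B C := by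
  intro w hw z hz
  obtain ⟨x, hx⟩ := hAB.2.1
  obtain ⟨y, hy⟩ := hAB.2.2
  have hxy := h x hx y hy
  have hne : w ≠ z := fun e => hz.2 (e ▸ hw.1)
  have hne' : x ≠ y := fun e => hy.2 (e ▸ hx.1)
  have e1 := hp.ne hne
  have e2 := hq.ne hne
  have e3 := hp.ne hne'
  have e4 := hq.ne hne'
  have hCB := hBC.symm.1
  have c1 := false_of_lt_of_lt hpA hpB hpC hqA hqB hqC hAB.1 hCB hx hy hz hw
  have c2 := false_of_lt_of_lt hqA hqB hqC hpA hpB hpC hAB.1 hCB hx hy hz hw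
  have c3 := false_of_lt_of_lt hpA.neg hpB.neg hpC.neg hqA.neg hqB.neg hqC.neg hAB.1 hCB
    hx hy hz hw
  have c4 := false_of_lt_of_lt hqA.neg hqB.neg hqC.neg hpA.neg hpB.neg hpC.neg hAB.1 hCB
    hx hy hz hw
  simp only [neg_lt_neg_iff] at c3 c4
  rcases lt_or_gt_of_ne e1 with f1 | f1 <;> rcases lt_or_gt_of_ne e2 with f2 | f2 <;>
    rcases lt_or_gt_of_ne e3 with f3 | f3 <;> rcases lt_or_gt_of_ne e4 with f4 | f4 <;>
    first
    | (exfalso; omega)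
    | omega
    | (exfalso; first | exact c1 f3 f1 f4 f2 | exact c2 f4 f2 f3 f1 | exact c3 f3 f1 f4 f2
                      | exact c4 f4 f2 f3 f1)

end Sign

/-! ### Components of the overlap graph -/

section Component

variable {X ι : Type*} {F : ι → Set X} {o : ι}

/-- The connected component of `o` in the overlap graph of a family of sets. -/
def overlapComponent (F : ι → Set X) (o : ι) : Set ι :=
  {v | Relation.ReflTransGen (fun u v => Overlap (F u) (F v)) o v}

/-- Two points are equivalent if the same sets of the component contain them. -/
def SameAtom (F : ι → Set X) (o : ι) (x y : X) : Prop :=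
  ∀ v ∈ overlapComponent F o, (x ∈ F v ↔ y ∈ F v)

theorem mem_overlapComponent_of_overlap {u v : ι} (hu : u ∈ overlapComponent F o)
    (h : Overlap (F u) (F v)) : v ∈ overlapComponent F o :=
  Relation.ReflTransGen.tail hu h

/-- Overlap is symmetric, so the induction may start at any member and not only at `o`. -/
theorem overlapComponent_induction {P : ι → Prop} {u : ι} (hu : u ∈ overlapComponent F o)
    (h : P u) (step : ∀ a ∈ overlapComponent F o, ∀ b, Overlap (F a) (F b) → P a → P b) :
    ∀ v ∈ overlapComponent F o, P v := by
  have ho : P o := by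
    have hrev : ∀ v, v ∈ overlapComponent F o → P v → P o := by
      intro v hv
      induction hv with
      | refl => exact id
      | tail hab hbc ih =>
        exact fun hc => ih (step _ (Relation.ReflTransGen.tail hab hbc) _ hbc.symm hc)
    exact hrev u hu h
  intro v hv
  induction hv with
  | refl => exact ho
  | tail hab hbc ih => exact step _ hab _ hbc ih

/-- Atoms are contiguous in every admissible ordering, hence can serve as the sections of a Q-node.
-/
theorem SameAtom.of_between {p : X → ℤ} (hF : ∀ v, ConvexPos p (F v))
    (hcov : ∀ x, ∃ v ∈ overlapComponent F o, x ∈ F v) {x y z : X} (h : SameAtom F o x z)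
    (hxy : p x ≤ p y) (hyz : p y ≤ p z) : SameAtom F o x y := by
  intro v hv
  refine ⟨fun hx => hF v x y z hx ((h v hv).1 hx) hxy hyz, fun hy => ?_⟩
  by_contra hx
  -- A set meeting the interval from `x` to `z` but missing `x` also misses `z`, so it stays inside.
  -- A set overlapping it cannot contain `x`, since it would then contain `z` and the whole former
  -- set. Propagation leaves `x` uncovered.
  have key : ∀ w ∈ overlapComponent F o, x ∉ F w ∧ ∃ t ∈ F w, p x ≤ p t ∧ p t ≤ p z := by
    refine overlapComponent_induction hv ⟨hx, y, hy, hxy, hyz⟩ ?_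
    rintro a ha b hab ⟨hxa, t, hta, hxt, htz⟩
    have hza : z ∉ F a := fun hza => hxa ((h a ha).2 hza)
    have hb := mem_overlapComponent_of_overlap ha hab
    have hin : ∀ s ∈ F a, p x ≤ p s ∧ p s ≤ p z := by
      intro s hs
      constructor
      · by_contra! hlt
        exact hxa (hF a s x t hs hta hlt.le hxt)
      · by_contra! hlt
        exact hza (hF a t z s hta hs htz hlt.le)
    obtain ⟨m, hma, hmb⟩ := hab.1
    obtain ⟨s, hsa, hsb⟩ := hab.2.1
    refine ⟨fun hxb => hsb ?_, m, hmb, hin m hma⟩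
    exact hF b x s z hxb ((h b hb).1 hxb) (hin s hsa).1 (hin s hsa).2
  obtain ⟨w, hw, hxw⟩ := hcov x
  exact (key w hw).1 hxw

theorem agreeOn_overlapComponent {p q : X → ℤ} (hp : Function.Injective p)
    (hq : Function.Injective q) (hpF : ∀ v, ConvexPos p (F v))
    (hqF : ∀ v, ConvexPos q (F v)) {u v : ι} (hu : u ∈ overlapComponent F o)
    (huv : Overlap (F u) (F v)) (h : AgreeOn p q (F u) (F v)) :
    ∀ a ∈ overlapComponent F o, ∀ b, Overlap (F a) (F b) → AgreeOn p q (F a) (F b) := by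
  refine overlapComponent_induction hu (fun w huw => ?_) ?_
  · exact (h.symm hp hq).trans hp hq (hpF _) (hpF _) (hpF _) (hqF _) (hqF _) (hqF _)
      huv.symm huw
  · intro a ha b hab iha w hbw
    exact (iha b hab).trans hp hq (hpF _) (hpF _) (hpF _) (hqF _) (hqF _) (hqF _) hab hbw

/-- For fixed `y`, agreement of the comparisons with `y` spreads through the component. By convexity
all points of a set missing `y` lie on one side of `y`, so one agreeing point per set suffices. It
comes from a difference if the preceding set contains `y`, and from the intersection otherwise. -/
theorem lt_iff_lt_of_agreeOn {p q : X → ℤ} (hp : Function.Injective p)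
    (hq : Function.Injective q) (hpF : ∀ v, ConvexPos p (F v))
    (hqF : ∀ v, ConvexPos q (F v)) (hcov : ∀ x, ∃ v ∈ overlapComponent F o, x ∈ F v)
    (h : ∀ a ∈ overlapComponent F o, ∀ b, Overlap (F a) (F b) → AgreeOn p q (F a) (F b))
    {x y : X} (hxy : ¬ SameAtom F o x y) : p x < p y ↔ q x < q y := by
  have side : ∀ {r : X → ℤ}, (∀ v, ConvexPos r (F v)) → ∀ {b x x' y}, x ∈ F b → x' ∈ F b →
      y ∉ F b → r x < r y → r x' < r y := by
    intro r hr b x x' y hx hx' hy hlt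
    by_contra! hle
    exact hy (hr b x y x' hx hx' hlt.le hle)
  have flip : ∀ {x y : X}, x ≠ y → ((p x < p y ↔ q x < q y) ↔ (p y < p x ↔ q y < q x)) := by
    intro x y hne
    have h1 := hp.ne hne
    have h2 := hq.ne hne
    omega
  have key : ∀ y, ∀ v ∈ overlapComponent F o, y ∉ F v →
      ∀ x ∈ F v, (p x < p y ↔ q x < q y) := by
    intro y
    obtain ⟨w, hw, hyw⟩ := hcov y
    refine overlapComponent_induction hw (fun hy => absurd hyw hy) ?_
    intro a ha b hab iha hyb x hxb
    obtain ⟨x', hx'b, hx'⟩ : ∃ x' ∈ F b, (p x' < p y ↔ q x' < q y) := by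
      by_cases hya : y ∈ F a
      · obtain ⟨x', hx'⟩ := hab.2.2
        exact ⟨x', hx'.1, (flip fun e => hx'.2 (by rwa [e])).2 (h a ha b hab y ⟨hya, hyb⟩ x' hx')⟩
      · obtain ⟨m, hma, hmb⟩ := hab.1
        exact ⟨m, hmb, iha hya m hma⟩
    exact ⟨fun hlt => side hqF hx'b hxb hyb (hx'.1 (side hpF hxb hx'b hyb hlt)),
      fun hlt => side hpF hx'b hxb hyb (hx'.2 (side hqF hxb hx'b hyb hlt))⟩
  unfold SameAtom at hxy
  push Not at hxy
  obtain ⟨v, hv, ⟨hx, hy⟩ | ⟨hx, hy⟩⟩ := hxy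
  · exact key y v hv hy x hx
  · exact (flip fun e => hx (by rwa [e])).2 (key x v hv hx y hy)

theorem subset_of_not_mem_overlapComponent {u v : ι} (hv : v ∉ overlapComponent F o)
    (hu : u ∈ overlapComponent F o) (huv : F u ⊆ F v) :
    ∀ w ∈ overlapComponent F o, F w ⊆ F v := by
  refine overlapComponent_induction hu huv ?_
  intro a ha b hab hav
  have hb := mem_overlapComponent_of_overlap ha hab
  have hno : ¬ Overlap (F b) (F v) := fun h => hv (mem_overlapComponent_of_overlap hb h)
  obtain ⟨m, hma, hmb⟩ := hab.1
  obtain ⟨s, hsa, hsb⟩ := hab.2.1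
  rcases subset_or_subset_of_not_overlap hno ⟨m, hmb, hav hma⟩ with h | h
  · exact h
  · exact absurd (h (hav hsa)) hsb

/-- The union of the component is closed under sets meeting it: an outside set either lies in a
member or contains all members, in particular `F o`, and then maximality applies. Connectedness
finishes. -/
theorem overlapComponent_covers (hne : (F o).Nonempty)
    (hmax : ∀ v, F o ⊆ F v → F v ⊆ F o)
    (hconn : ∀ Y : Set X, Y.Nonempty → (∀ v, (F v ∩ Y).Nonempty → F v ⊆ Y) → Y = Set.univ)
    (x : X) : ∃ v ∈ overlapComponent F o, x ∈ F v := by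
  have ho : o ∈ overlapComponent F o := Relation.ReflTransGen.refl
  have := hconn {x | ∃ v ∈ overlapComponent F o, x ∈ F v}
    (hne.mono fun x hx => ⟨o, ho, hx⟩) (by
      rintro v ⟨x, hxv, u, hu, hxu⟩ y hy
      by_cases hv : v ∈ overlapComponent F o
      · exact ⟨v, hv, hy⟩
      rcases subset_or_subset_of_not_overlap
        (fun h => hv (mem_overlapComponent_of_overlap hu h)) ⟨x, hxu, hxv⟩ with h | h
      · exact ⟨o, ho, hmax v (subset_of_not_mem_overlapComponent hv hu h o ho) hy⟩
      · exact ⟨u, hu, h hy⟩)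
  exact Set.eq_univ_iff_forall.1 this x

/-- A set outside the component cannot contain a member, as it would then contain all of them and be
everything. So it lies inside each member it meets, and its vertex belongs to the subtree of a
single section. -/
theorem sameAtom_of_not_mem_overlapComponent (hU : ∀ v, F v ≠ Set.univ)
    (hcov : ∀ x, ∃ v ∈ overlapComponent F o, x ∈ F v) {v : ι}
    (hv : v ∉ overlapComponent F o) {x y : X} (hx : x ∈ F v) (hy : y ∈ F v) :
    SameAtom F o x y := by
  have key : ∀ w ∈ overlapComponent F o, ∀ x ∈ F v, ∀ y ∈ F v, x ∈ F w → y ∈ F w := by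
    intro w hw x hx y hy hxw
    rcases subset_or_subset_of_not_overlap
      (fun h => hv (mem_overlapComponent_of_overlap hw h)) ⟨x, hxw, hx⟩ with h | h
    · refine absurd (Set.eq_univ_of_forall fun z => ?_) (hU v)
      obtain ⟨u, hu, hzu⟩ := hcov z
      exact subset_of_not_mem_overlapComponent hv hw h u hu hzu
    · exact h hy
  exact fun w hw => ⟨key w hw x hx y hy, key w hw y hy x hx⟩

theorem exists_overlap_of_mem (hU : ∀ v, F v ≠ Set.univ)
    (hcov : ∀ x, ∃ v ∈ overlapComponent F o, x ∈ F v) {v : ι}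
    (hv : v ∈ overlapComponent F o) : ∃ w, Overlap (F v) (F w) := by
  by_contra! hno
  have key : ∀ w ∈ overlapComponent F o, F w ⊆ F v := by
    have : ∀ w ∈ overlapComponent F o, w = v := by
      refine overlapComponent_induction hv rfl ?_
      rintro a ha b hab rfl
      exact absurd hab (hno b)
    intro w hw
    rw [this w hw]
  refine hU v (Set.eq_univ_of_forall fun z => ?_)
  obtain ⟨u, hu, hzu⟩ := hcov z
  exact key u hu hzu

end Component

/-! ### Cutting an ordering into contiguous classes -/

theorem filter_lt_succ_of_pairwise {α : Type*} {f : α → ℕ} {L : List α}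
    (h : L.Pairwise fun x y => f x ≤ f y) (m : ℕ) :
    L.filter (fun x => f x < m + 1) =
      L.filter (fun x => f x < m) ++ L.filter (fun x => f x = m) := by
  simp only [Nat.lt_succ_iff]
  induction L with
  | nil => rfl
  | cons x L ih =>
    rw [List.pairwise_cons] at h
    have ih := ih h.2
    rcases lt_trichotomy (f x) m with hlt | heq | hgt
    · have h1 : f x ≤ m := by omega
      have h2 : f x ≠ m := by omega
      simp [hlt, h1, h2, ih]
    · have h1 : L.filter (fun x => f x < m) = [] := by
        rw [List.filter_eq_nil_iff]
        intro y hy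
        have := h.1 y hy
        simp only [decide_eq_true_eq]
        omega
      rw [h1] at ih
      simp [heq, h1, ih]
    · have h1 : L.filter (fun x => f x < m) = [] := by
        rw [List.filter_eq_nil_iff]
        intro y hy
        have := h.1 y hy
        simp only [decide_eq_true_eq]
        omega
      rw [h1] at ih
      have h2 : ¬ f x ≤ m := by omega
      have h3 : ¬ f x < m := by omega
      have h4 : f x ≠ m := by omega
      simp [h1, h2, h3, h4, ih]

theorem flatten_ofFn_filter {α : Type*} {k : ℕ} {c : α → Fin k} {L : List α}
    (h : L.Pairwise fun x y => c x ≤ c y) :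
    (List.ofFn fun i => L.filter fun x => c x = i).flatten = L := by
  have key : ∀ m, (List.ofFn fun i : Fin m => L.filter fun x => (c x : ℕ) = i).flatten =
      L.filter (fun x => (c x : ℕ) < m) := by
    intro m
    induction m with
    | zero => simp
    | succ m ih =>
      rw [List.ofFn_succ', List.concat_eq_append, List.flatten_append,
        filter_lt_succ_of_pairwise (f := fun x => (c x : ℕ)) h m, ← ih]
      simp
  have := key k
  rw [List.filter_eq_self.2 (by simp)] at this
  simpa [Fin.ext_iff] using this

/-- Classes are identified by the index of their first representative in `L`; contiguity makes this
index monotone along `L`, and the values occurring are then renumbered by `Fin k`. -/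
theorem exists_class_function {α : Type*} {L : List α} (hL : L ≠ []) (r : α → α → Prop)
    (hrefl : ∀ x, r x x) (hsymm : ∀ x y, r x y → r y x)
    (htrans : ∀ x y z, r x y → r y z → r x z)
    (hcont : ∀ i j k : Fin L.length, i ≤ j → j ≤ k → r (L.get i) (L.get k) →
      r (L.get i) (L.get j)) :
    ∃ (k : ℕ) (c : α → Fin k), (L.Pairwise fun x y => c x ≤ c y) ∧
      (∀ x ∈ L, ∀ y ∈ L, c x = c y ↔ r x y) ∧ ∀ i, ∃ x ∈ L, c x = i := by
  classical
  let f : α → ℕ := fun x => L.findIdx fun y => decide (r y x)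
  have hlt : ∀ x ∈ L, f x < L.length := fun x hx =>
    List.findIdx_lt_length_of_exists ⟨x, hx, by simpa using hrefl x⟩
  have hf : ∀ x (hx : x ∈ L), r (L[f x]'(hlt x hx)) x := by
    intro x hx
    simpa using List.findIdx_getElem (xs := L) (p := fun y => decide (r y x)) (w := hlt x hx)
  have hmin : ∀ x j (hj : j < L.length), r (L[j]) x → f x ≤ j := by
    intro x j hj hr
    by_contra! hlt'
    have := List.not_of_lt_findIdx hlt'
    simp [hr] at this
  have heq : ∀ x ∈ L, ∀ y ∈ L, f x = f y ↔ r x y := by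
    intro x hx y hy
    constructor
    · intro h
      have h1 := hf x hx
      have h2 := hf y hy
      simp only [h] at h1
      exact htrans _ _ _ (hsymm _ _ h1) h2
    · intro h
      apply le_antisymm
      · exact hmin _ _ (hlt y hy) (htrans _ _ _ (hf y hy) (hsymm _ _ h))
      · exact hmin _ _ (hlt x hx) (htrans _ _ _ (hf x hx) h)
  have hmono : ∀ i j : Fin L.length, i < j → f (L.get i) ≤ f (L.get j) := by
    intro i j hij
    by_contra! hgt
    have hj := hlt _ (List.get_mem L j)
    have hi := hmin (L.get i) i i.2 (hrefl _)
    have h1 := hcont ⟨f (L.get j), hj⟩ i j (by simp only [Fin.le_def]; omega) hij.le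
      (hf _ (List.get_mem L j))
    have := hmin _ _ hj h1
    omega
  let M := L.toFinset.image f
  have hM : ∀ x ∈ L, f x ∈ M := fun x hx =>
    Finset.mem_image_of_mem f (List.mem_toFinset.2 hx)
  obtain ⟨x₀, hx₀⟩ := List.exists_mem_of_ne_nil L hL
  let e := M.orderIsoOfFin rfl
  -- Outside `L` the value is irrelevant; the class of `x₀` serves as a default.
  let c : α → Fin M.card := fun x =>
    if h : f x ∈ M then e.symm ⟨f x, h⟩ else e.symm ⟨f x₀, hM x₀ hx₀⟩
  have hc : ∀ x (hx : x ∈ L), c x = e.symm ⟨f x, hM x hx⟩ := fun x hx => dif_pos (hM x hx)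
  refine ⟨M.card, c, ?_, ?_, ?_⟩
  · rw [List.pairwise_iff_get]
    intro i j hij
    rw [hc _ (List.get_mem L i), hc _ (List.get_mem L j), e.symm.le_iff_le]
    exact hmono i j hij
  · intro x hx y hy
    rw [hc x hx, hc y hy, e.symm.injective.eq_iff, Subtype.mk.injEq]
    exact heq x hx y hy
  · intro i
    obtain ⟨x, hx, hxi⟩ := Finset.mem_image.1 (e i).2
    have hx := List.mem_toFinset.1 hx
    refine ⟨x, hx, ?_⟩
    rw [hc x hx, OrderIso.symm_apply_eq]
    exact Subtype.ext hxi

/-- Renumbering the classes by their order of appearance in another ordering gives the permutation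
of the subtrees of a P-node. -/
theorem exists_perm_pairwise {α : Type*} {L : List α} (hL : L ≠ []) {k : ℕ} {c : α → Fin k}
    (hsurj : ∀ i, ∃ x ∈ L, c x = i)
    (hcont : ∀ i j k : Fin L.length, i ≤ j → j ≤ k → c (L.get i) = c (L.get k) →
      c (L.get i) = c (L.get j)) :
    ∃ σ : Equiv.Perm (Fin k), L.Pairwise fun x y => σ (c x) ≤ σ (c y) := by
  obtain ⟨k', c', hmono, hcc, hsurj'⟩ := exists_class_function hL (fun x y => c x = c y)
    (fun _ => rfl) (fun _ _ h => h.symm) (fun _ _ _ h h' => h.trans h') hcont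
  choose x hx hxi using hsurj
  have hc' : ∀ y ∈ L, c' (x (c y)) = c' y := fun y hy => (hcc _ (hx _) _ hy).2 (hxi _)
  have hbij : Function.Bijective fun i => c' (x i) := by
    constructor
    · intro i j hij
      have := (hcc _ (hx i) _ (hx j)).1 hij
      rwa [hxi, hxi] at this
    · intro i
      obtain ⟨y, hy, rfl⟩ := hsurj' i
      exact ⟨c y, hc' y hy⟩
  obtain rfl : k = k' := by simpa using Fintype.card_of_bijective hbij
  refine ⟨Equiv.ofBijective _ hbij, hmono.imp_of_mem fun {y z} hy hz hyz => ?_⟩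
  simpa [hc' y hy, hc' z hz] using hyz

/-- The members of the list that contain any given vertex are consecutive. -/
def ConsecutiveList {V : Type*} (L : List (Finset V)) : Prop :=
  ∀ (v : V) (i j k : Fin L.length), i ≤ j → j ≤ k →
    v ∈ L.get i → v ∈ L.get k → v ∈ L.get j

section Blocks

variable {V : Type*}

theorem ConsecutiveList.sublist {L L' : List (Finset V)} (h : ConsecutiveList L)
    (hL : L'.Sublist L) : ConsecutiveList L' := by
  obtain ⟨f, hf⟩ := List.sublist_iff_exists_fin_orderEmbedding_get_eq.1 hL
  intro v i j k hij hjk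
  rw [hf, hf, hf]
  exact h v _ _ _ (f.monotone hij) (f.monotone hjk)

variable [DecidableEq V]

theorem ConsecutiveList.map_sdiff {L : List (Finset V)} (h : ConsecutiveList L)
    (U : Finset V) : ConsecutiveList (L.map (· \ U)) := by
  intro v i j k hij hjk
  simp only [List.get_eq_getElem, List.getElem_map, Finset.mem_sdiff]
  have hl : (L.map (· \ U)).length = L.length := by simp
  exact fun h1 h2 => ⟨h v (i.cast hl) (j.cast hl) (k.cast hl) hij hjk h1.1 h2.1, h1.2⟩

theorem nodup_map_sdiff {L : List (Finset V)} (h : L.Nodup) {U : Finset V}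
    (hU : ∀ C ∈ L, U ⊆ C) : (L.map (· \ U)).Nodup := by
  refine List.Nodup.map_on (fun C hC D hD hCD => ?_) h
  rw [← Finset.union_sdiff_of_subset (hU C hC), ← Finset.union_sdiff_of_subset (hU D hD)]
  exact congrArg (U ∪ ·) hCD

/-- The members of `L` of class `i`, without the vertices in `S i`. -/
def block {k : ℕ} (L : List (Finset V)) (c : Finset V → Fin k) (S : Fin k → Finset V)
    (i : Fin k) : List (Finset V) :=
  (L.filter fun C => c C = i).map (· \ S i)

variable {k : ℕ} {L L' : List (Finset V)} {c : Finset V → Fin k} {S : Fin k → Finset V}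

theorem flatten_block (h : L.Pairwise fun C D => c C ≤ c D) (hS : ∀ C ∈ L, S (c C) ⊆ C) :
    (List.ofFn fun i => (block L c S i).map (S i ∪ ·)).flatten = L := by
  have : ∀ i, (block L c S i).map (S i ∪ ·) = L.filter fun C => c C = i := by
    intro i
    rw [block, List.map_map]
    refine (List.map_congr_left fun C hC => ?_).trans (List.map_id _)
    obtain ⟨hC, hi⟩ := List.mem_filter.1 hC
    have hi : c C = i := by simpa using hi
    exact Finset.union_sdiff_of_subset (hi ▸ hS C hC)
  simp only [this]
  exact flatten_ofFn_filter h

theorem block_perm (h : L'.Perm L) (i : Fin k) : (block L' c S i).Perm (block L c S i) :=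
  (h.filter _).map _

theorem ConsecutiveList.block (h : ConsecutiveList L) (i : Fin k) :
    ConsecutiveList (block L c S i) :=
  (h.sublist List.filter_sublist).map_sdiff _

theorem nodup_block (h : L.Nodup) (hS : ∀ C ∈ L, S (c C) ⊆ C) (i : Fin k) :
    (block L c S i).Nodup := by
  refine nodup_map_sdiff (h.filter _) fun C hC => ?_
  obtain ⟨hC, hi⟩ := List.mem_filter.1 hC
  have hi : c C = i := by simpa using hi
  exact hi ▸ hS C hC

theorem exists_mem_block {v : V} {i : Fin k} :
    (∃ C ∈ block L c S i, v ∈ C) ↔ v ∉ S i ∧ ∃ C ∈ L, c C = i ∧ v ∈ C := by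
  simp only [block, List.mem_map, List.mem_filter, decide_eq_true_eq]
  constructor
  · rintro ⟨_, ⟨C, ⟨hC, hi⟩, rfl⟩, hv⟩
    rw [Finset.mem_sdiff] at hv
    exact ⟨hv.2, C, hC, hi, hv.1⟩
  · rintro ⟨hv, C, hC, hi, hvC⟩
    exact ⟨_, ⟨C, ⟨hC, hi⟩, rfl⟩, Finset.mem_sdiff.2 ⟨hvC, hv⟩⟩

theorem block_ne_nil (hsurj : ∀ i, ∃ C ∈ L, c C = i) (i : Fin k) : block L c S i ≠ [] := by
  obtain ⟨C, hC, hi⟩ := hsurj i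
  exact List.ne_nil_of_mem (List.mem_map_of_mem (List.mem_filter.2 ⟨hC, by simpa using hi⟩))

theorem length_block_lt (hk : 2 ≤ k) (hsurj : ∀ i, ∃ C ∈ L, c C = i) (i : Fin k) :
    (block L c S i).length < L.length := by
  rw [block, List.length_map]
  have : Nontrivial (Fin k) := Fin.nontrivial_iff_two_le.2 hk
  obtain ⟨j, hj⟩ := exists_ne i
  obtain ⟨C, hC, rfl⟩ := hsurj j
  exact List.length_filter_lt_length_iff_exists.2 ⟨C, hC, by simpa using hj⟩

end Blocks

theorem nodup_flatten_fibers {V : Type*} {k : ℕ} (R : Finset V) (f : V → Fin k) :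
    (List.ofFn fun i => (R.filter fun v => f v = i).toList).flatten.Nodup := by
  rw [List.nodup_flatten, List.pairwise_ofFn]
  refine ⟨?_, ?_⟩
  · intro l hl
    obtain ⟨i, rfl⟩ := List.mem_ofFn.1 hl
    exact Finset.nodup_toList _
  · intro i j hij v hi hj
    simp only [Finset.mem_toList, Finset.mem_filter] at hi hj
    exact hij.ne (hi.2.symm.trans hj.2)

theorem mem_flatten_fibers {V : Type*} {k : ℕ} {R : Finset V} {f : V → Fin k} {v : V} :
    v ∈ (List.ofFn fun i => (R.filter fun v => f v = i).toList).flatten ↔ v ∈ R := by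
  simp [List.mem_flatten, List.mem_ofFn]

/-! ### Assembling a tree from trees of the blocks -/

namespace MPQTree

variable {V : Type*} [DecidableEq V]

/-- The tree `T` represents the consecutive orderings of the members of `L`, and `L` is its
frontier. -/
structure IsTreeOf (L : List (Finset V)) (T : MPQTree V) : Prop where
  normal : T.IsNormal
  vertices_nodup : T.vertices.Nodup
  mem_vertices : ∀ v, v ∈ T.vertices ↔ ∃ C ∈ L, v ∈ C
  frontier_eq : T.frontier = L
  complete : ∀ L', L'.Perm L → ConsecutiveList L' → ∃ T', Equivalent T T' ∧ T'.frontier = L'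

variable {k : ℕ} {L : List (Finset V)} {c : Finset V → Fin k}

theorem isTreeOf_singleton (C : Finset V) : IsTreeOf [C] (P C.toList 0 Fin.elim0) := by
  refine ⟨⟨by simp, fun i => i.elim0⟩, ?_, ?_, ?_, ?_⟩
  · simp [vertices, C.nodup_toList]
  · simp [vertices]
  · simp [frontier]
  · intro L' hL' _
    rw [List.perm_singleton] at hL'
    subst hL'
    exact ⟨P C.toList 0 Fin.elim0, .permute _ _ _ _ 1 fun i => i.elim0, by simp [frontier]⟩

theorem isTreeOf_P (hk : k ≠ 0) {U : Finset V} (hU : ∀ C ∈ L, U ⊆ C)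
    (hmono : L.Pairwise fun C D => c C ≤ c D) (hsurj : ∀ i, ∃ C ∈ L, c C = i)
    {T : Fin k → MPQTree V} (hT : ∀ i, IsTreeOf (block L c (fun _ => U) i) (T i))
    (hone : k = 1 → U.Nonempty ∧ ∀ i, IsQ (T i))
    (hv : ∀ v, v ∉ U → ∀ C ∈ L, ∀ D ∈ L, v ∈ C → v ∈ D → c C = c D)
    (hcomp : ∀ L', L'.Perm L → ConsecutiveList L' →
      ∃ σ : Equiv.Perm (Fin k), L'.Pairwise fun C D => σ (c C) ≤ σ (c D)) :
    IsTreeOf L (P U.toList k T) := by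
  have hmem : ∀ i v, v ∈ (T i).vertices ↔ v ∉ U ∧ ∃ C ∈ L, c C = i ∧ v ∈ C := fun i v => by
    rw [(hT i).mem_vertices, exists_mem_block]
  have hfr : ∀ (T' : Fin k → MPQTree V), (P U.toList k T').frontier =
      (List.ofFn fun i => (T' i).frontier.map (U ∪ ·)).flatten := by
    intro T'
    simp [frontier, hk]
  refine ⟨⟨fun h => ?_, fun i => (hT i).normal⟩, ?_, ?_, ?_, ?_⟩
  · obtain ⟨h1, h2⟩ := hone h
    exact ⟨by simpa using h1.ne_empty, h2⟩
  · rw [vertices, List.nodup_append]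
    refine ⟨U.nodup_toList, ?_, ?_⟩
    · rw [List.nodup_flatten, List.pairwise_ofFn]
      refine ⟨?_, ?_⟩
      · intro l hl
        obtain ⟨i, rfl⟩ := List.mem_ofFn.1 hl
        exact (hT i).vertices_nodup
      · intro i j hij v hi hj
        obtain ⟨hvU, C, hC, rfl, hvC⟩ := (hmem i v).1 hi
        obtain ⟨-, D, hD, rfl, hvD⟩ := (hmem j v).1 hj
        exact hij.ne (hv v hvU C hC D hD hvC hvD)
    · rintro v hvU w hw rfl
      obtain ⟨l, hl, hvl⟩ := List.mem_flatten.1 hw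
      obtain ⟨i, rfl⟩ := List.mem_ofFn.1 hl
      exact ((hmem i v).1 hvl).1 (by simpa using hvU)
  · intro v
    simp only [vertices, List.mem_append, Finset.mem_toList, List.mem_flatten, List.mem_ofFn]
    constructor
    · rintro (h | ⟨_, ⟨i, rfl⟩, h⟩)
      · obtain ⟨C, hC, -⟩ := hsurj ⟨0, Nat.pos_of_ne_zero hk⟩
        exact ⟨C, hC, hU C hC h⟩
      · obtain ⟨-, C, hC, -, h⟩ := (hmem i v).1 h
        exact ⟨C, hC, h⟩
    · rintro ⟨C, hC, h⟩
      by_cases hvU : v ∈ U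
      · exact Or.inl hvU
      · exact Or.inr ⟨_, ⟨c C, rfl⟩, (hmem _ v).2 ⟨hvU, C, hC, rfl, h⟩⟩
  · rw [hfr]
    simp only [(hT _).frontier_eq]
    exact flatten_block (S := fun _ => U) hmono hU
  · intro L' hL' hcons
    obtain ⟨σ, hσ⟩ := hcomp L' hL' hcons
    -- The `i`-th subtree from the left must hold the class that `σ` sends to `i`.
    choose T' hT' hf using fun i => (hT (σ.symm i)).complete _
      (block_perm hL' _) (hcons.block _)
    refine ⟨P U.toList k T', .permute _ _ _ _ σ.symm hT', ?_⟩
    rw [hfr]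
    simp only [hf]
    refine Eq.trans ?_ (flatten_block (S := fun _ => U) hσ fun C hC => hU C (hL'.mem_iff.1 hC))
    simp [block, Equiv.eq_symm_apply]

/-- By `hcomp` every admissible ordering lists the sections forwards or backwards; these are the
cases `keep` and `reverse` of `Equivalent`. -/
theorem isTreeOf_Q (hk : 3 ≤ k) (hmono : L.Pairwise fun C D => c C ≤ c D)
    (hsurj : ∀ i, ∃ C ∈ L, c C = i) {R : Finset V} {a b : V → Fin k}
    (hab : ∀ v ∈ R, a v < b v ∧ ¬ ((a v : ℕ) = 0 ∧ (b v : ℕ) + 1 = k))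
    (hR : ∀ v ∈ R, ∀ C ∈ L, v ∈ C ↔ a v ≤ c C ∧ c C ≤ b v)
    (hv : ∀ v, v ∉ R → ∀ C ∈ L, ∀ D ∈ L, v ∈ C → v ∈ D → c C = c D)
    {T : Fin k → MPQTree V}
    (hT : ∀ i, IsTreeOf (block L c (fun i => R.filter fun v => a v ≤ i ∧ i ≤ b v) i) (T i))
    (hcomp : ∀ L', L'.Perm L → ConsecutiveList L' →
      (L'.Pairwise fun C D => c C ≤ c D) ∨ L'.Pairwise fun C D => c D ≤ c C) :
    IsTreeOf L (Q k (fun i => (R.filter fun v => a v = i).toList)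
      (fun i => (R.filter fun v => b v = i).toList) T) := by
  set S : Fin k → Finset V := fun i => R.filter fun v => a v ≤ i ∧ i ≤ b v with hS
  have hmemS : ∀ i v, v ∈ S i ↔ v ∈ R ∧ a v ≤ i ∧ i ≤ b v := by simp [hS]
  have hSC : ∀ C ∈ L, S (c C) ⊆ C := by
    intro C hC v hvS
    obtain ⟨hvR, h⟩ := (hmemS _ _).1 hvS
    exact (hR v hvR C hC).2 h
  have hmem : ∀ i v, v ∈ (T i).vertices ↔ v ∉ R ∧ ∃ C ∈ L, c C = i ∧ v ∈ C := by
    intro i v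
    rw [(hT i).mem_vertices, exists_mem_block, hmemS]
    constructor
    · rintro ⟨h1, C, hC, rfl, hvC⟩
      exact ⟨fun hvR => h1 ⟨hvR, (hR v hvR C hC).1 hvC⟩, C, hC, rfl, hvC⟩
    · rintro ⟨h1, h2⟩
      exact ⟨fun h => h1 h.1, h2⟩
  have hsec : ∀ i, sectionSet (fun i => (R.filter fun v => a v = i).toList)
      (fun i => (R.filter fun v => b v = i).toList) i = S i := by
    intro i
    ext v
    simp only [mem_sectionSet, hmemS, Finset.mem_toList, Finset.mem_filter]
    constructor
    · rintro ⟨⟨_, h1, hvR, rfl⟩, _, h2, -, rfl⟩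
      exact ⟨hvR, h1, h2⟩
    · rintro ⟨hvR, h1, h2⟩
      exact ⟨⟨_, h1, hvR, rfl⟩, _, h2, hvR, rfl⟩
  have hsec' : ∀ i, sectionSet (fun i : Fin k => (R.filter fun v => b v = i.rev).toList)
      (fun i => (R.filter fun v => a v = i.rev).toList) i = S i.rev := by
    intro i
    ext v
    simp only [mem_sectionSet, hmemS, Finset.mem_toList, Finset.mem_filter]
    constructor
    · rintro ⟨⟨p, h1, hvR, h1'⟩, q, h2, -, h2'⟩
      rw [h1', h2', Fin.rev_le_rev, Fin.rev_le_rev]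
      exact ⟨hvR, h2, h1⟩
    · rintro ⟨hvR, h1, h2⟩
      refine ⟨⟨(b v).rev, ?_, hvR, by simp⟩, (a v).rev, ?_, hvR, by simp⟩
      · rwa [← Fin.rev_le_rev, Fin.rev_rev]
      · rwa [ge_iff_le, ← Fin.rev_le_rev, Fin.rev_rev]
  refine ⟨⟨hk, ?_, ?_, fun i => (hT i).normal⟩, ?_, ?_, ?_, ?_⟩
  · rw [List.perm_ext_iff_of_nodup (nodup_flatten_fibers R a) (nodup_flatten_fibers R b)]
    intro v
    rw [mem_flatten_fibers, mem_flatten_fibers]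
  · intro i j v hi hj
    simp only [Finset.mem_toList, Finset.mem_filter] at hi hj
    obtain ⟨hvR, rfl⟩ := hi
    obtain ⟨-, rfl⟩ := hj
    exact hab v hvR
  · rw [vertices, List.nodup_flatten, List.pairwise_ofFn]
    refine ⟨?_, ?_⟩
    · intro l hl
      obtain ⟨i, rfl⟩ := List.mem_ofFn.1 hl
      rw [List.nodup_append]
      refine ⟨Finset.nodup_toList _, (hT i).vertices_nodup, ?_⟩
      rintro v h1 w h2 rfl
      simp only [Finset.mem_toList, Finset.mem_filter] at h1
      exact ((hmem i v).1 h2).1 h1.1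
    · intro i j hij v hi hj
      simp only [List.mem_append, Finset.mem_toList, Finset.mem_filter, hmem] at hi hj
      rcases hi with ⟨h1, h2⟩ | ⟨h1, C, hC, hi, hvC⟩ <;>
        rcases hj with ⟨h3, h4⟩ | ⟨h3, D, hD, hj, hvD⟩
      · exact hij.ne (h2.symm.trans h4)
      · exact h3 h1
      · exact h1 h3
      · exact hij.ne (hi.symm.trans ((hv v h1 C hC D hD hvC hvD).trans hj))
  · intro v
    simp only [vertices, List.mem_flatten, List.mem_ofFn]
    constructor
    · rintro ⟨_, ⟨i, rfl⟩, h⟩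
      simp only [List.mem_append, Finset.mem_toList, Finset.mem_filter, hmem] at h
      rcases h with ⟨h1, rfl⟩ | ⟨-, C, hC, -, h⟩
      · obtain ⟨C, hC, hCa⟩ := hsurj (a v)
        exact ⟨C, hC, (hR v h1 C hC).2 ⟨hCa.ge, hCa.le.trans (hab v h1).1.le⟩⟩
      · exact ⟨C, hC, h⟩
    · rintro ⟨C, hC, h⟩
      by_cases hvR : v ∈ R
      · exact ⟨_, ⟨a v, rfl⟩, by simp [hvR]⟩
      · exact ⟨_, ⟨c C, rfl⟩, List.mem_append_right _ ((hmem _ v).2 ⟨hvR, C, hC, rfl, h⟩)⟩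
  · simp only [frontier, (hT _).frontier_eq, hsec]
    exact flatten_block hmono hSC
  · intro L' hL' hcons
    have hSC' : ∀ C ∈ L', S (c C) ⊆ C := fun C hC => hSC C (hL'.mem_iff.1 hC)
    rcases hcomp L' hL' hcons with h | h
    · choose T' hT' hf using fun i => (hT i).complete _ (block_perm hL' _) (hcons.block _)
      refine ⟨_, .keep _ _ _ _ T' hT', ?_⟩
      simp only [frontier, hf, hsec]
      exact flatten_block h hSC'
    · choose T' hT' hf using fun i => (hT (Fin.rev i)).complete _
        (block_perm hL' _) (hcons.block _)
      refine ⟨_, .reverse _ _ _ _ T' hT', ?_⟩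
      simp only [frontier, hf, hsec']
      have := flatten_block (L := L') (c := fun C => (c C).rev) (S := fun i => S i.rev)
        (h.imp fun hCD => Fin.rev_le_rev.2 hCD) (by simpa using hSC')
      refine Eq.trans ?_ this
      simp [block, Fin.rev_eq_iff]

end MPQTree

/-! ### Existence of an MPQ-tree -/

section Positions

variable {V : Type*} [DecidableEq V] {L L' : List (Finset V)}

/-- The positions in `L'` of the members of `L`. -/
def pos (L L' : List (Finset V)) (C : {C // C ∈ L}) : ℤ := L'.idxOf C.1

theorem pos_lt_pos {L'} {C D : {C // C ∈ L}} :
    pos L L' C < pos L L' D ↔ L'.idxOf C.1 < L'.idxOf D.1 := by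
  simp [pos]

theorem pos_injective (h : L'.Perm L) : Function.Injective (pos L L') := by
  intro C D hCD
  have : L'.idxOf C.1 = L'.idxOf D.1 := by simpa [pos] using hCD
  exact Subtype.ext ((List.idxOf_inj (h.mem_iff.2 C.2)).1 this)

theorem ConsecutiveList.convexPos (h : ConsecutiveList L') (hL : L'.Perm L) (v : V) :
    ConvexPos (pos L L') {C : {C // C ∈ L} | v ∈ C.1} := by
  have hlt : ∀ C : {C // C ∈ L}, L'.idxOf C.1 < L'.length := fun C =>
    List.idxOf_lt_length_of_mem (hL.mem_iff.2 C.2)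
  intro a b c ha hc hab hbc
  have := h v ⟨_, hlt a⟩ ⟨_, hlt b⟩ ⟨_, hlt c⟩ (by simpa [pos] using hab)
    (by simpa [pos] using hbc)
  simp only [List.get_eq_getElem, List.getElem_idxOf] at this
  exact this ha hc

theorem pairwise_of_idxOf_lt {R : Finset V → Finset V → Prop} (hnd : L.Nodup)
    (h : ∀ C ∈ L, ∀ D ∈ L, L.idxOf C < L.idxOf D → R C D) : L.Pairwise R := by
  rw [List.pairwise_iff_get]
  intro i j hij
  refine h _ (List.get_mem L i) _ (List.get_mem L j) ?_
  rw [List.get_eq_getElem, List.get_eq_getElem, hnd.idxOf_getElem, hnd.idxOf_getElem]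
  exact hij

theorem of_pairwise_of_idxOf_lt {R : Finset V → Finset V → Prop} (h : L.Pairwise R)
    {C D : Finset V} (hC : C ∈ L) (hD : D ∈ L) (hlt : L.idxOf C < L.idxOf D) : R C D := by
  have := List.pairwise_iff_getElem.1 h _ _ (List.idxOf_lt_length_of_mem hC)
    (List.idxOf_lt_length_of_mem hD) hlt
  rwa [List.getElem_idxOf, List.getElem_idxOf] at this

end Positions

/-- Two members of `L` share a vertex outside `U`. -/
def SharesVertex {V : Type*} (L : List (Finset V)) (U C D : Finset V) : Prop :=
  C ∈ L ∧ D ∈ L ∧ ∃ v ∉ U, v ∈ C ∧ v ∈ D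

instance {V : Type*} (L : List (Finset V)) (U : Finset V) : Std.Symm (SharesVertex L U) where
  symm _ _ := fun ⟨hC, hD, v, hv, hvC, hvD⟩ => ⟨hD, hC, v, hv, hvD, hvC⟩

/-- If position `j` were not reachable from `i`, no chain could pass it: two cliques on either side
of `j` sharing a vertex outside `U` share it with the clique at `j`. Everything reachable would then
lie before `j`, against `j ≤ k`. -/
theorem reflTransGen_of_between {V : Type*} {L L' : List (Finset V)} (hnd : L.Nodup) (hL' : L'.Perm L)
    (hcons : ConsecutiveList L') {U : Finset V} {i j k : Fin L'.length} (hij : i ≤ j)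
    (hjk : j ≤ k)
    (h : Relation.ReflTransGen (SharesVertex L U)
      (L'.get i) (L'.get k)) :
    Relation.ReflTransGen (SharesVertex L U)
      (L'.get i) (L'.get j) := by
  by_contra hno
  have key : ∀ D, Relation.ReflTransGen (SharesVertex L U)
      (L'.get i) D → ∃ d < j, L'.get d = D := by
    intro D hD
    induction hD with
    | refl =>
      refine ⟨i, lt_of_le_of_ne hij ?_, rfl⟩
      rintro rfl
      exact hno .refl
    | @tail D E hD hDE ih =>
      obtain ⟨d, hdj, rfl⟩ := ih
      obtain ⟨hdL, hE, v, hvU, hvD, hvE⟩ := hDE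
      obtain ⟨e, rfl⟩ := List.get_of_mem (hL'.mem_iff.2 hE)
      refine ⟨e, ?_, rfl⟩
      by_contra! hje
      exact hno (hD.tail ⟨hdL, hL'.mem_iff.1 (L'.get_mem j), v, hvU, hvD,
        hcons v d j e hdj.le hje hvD hvE⟩)
  obtain ⟨d, hdj, hd⟩ := key _ h
  have := List.nodup_iff_injective_get.1 (hL'.nodup_iff.2 hnd) hd
  subst this
  exact absurd hjk (not_le_of_gt hdj)

namespace MPQTree

variable {V : Type*} [DecidableEq V]

/-- The Q-node stores the overlap component of an inclusion-maximal vertex set `F o`, and its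
sections are the atoms. All other vertices lie within single atoms and are handled by `ih`. -/
theorem exists_isQ_isTreeOf {L : List (Finset V)} (hnd : L.Nodup) (hcons : ConsecutiveList L)
    (hlen : 2 ≤ L.length) (hU : ∀ v, ∃ C ∈ L, v ∉ C)
    (hconn : ∀ Y : Set (Finset V), (∃ C ∈ L, C ∈ Y) →
      (∀ v, ∀ C ∈ L, ∀ D ∈ L, v ∈ C → v ∈ D → C ∈ Y → D ∈ Y) → ∀ C ∈ L, C ∈ Y)
    (ih : ∀ L' : List (Finset V), L'.length < L.length → L' ≠ [] → L'.Nodup →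
      ConsecutiveList L' → ∃ T, IsTreeOf L' T) :
    ∃ T, IsQ T ∧ IsTreeOf L T := by
  classical
  let F : V → Set {C // C ∈ L} := fun v => {C | v ∈ C.1}
  have hL : L ≠ [] := by
    rintro rfl
    simp at hlen
  obtain ⟨C₀, hC₀⟩ := List.exists_mem_of_ne_nil L hL
  have hFU : ∀ v, F v ≠ Set.univ := by
    intro v hv
    obtain ⟨C, hC, hvC⟩ := hU v
    exact hvC (Set.eq_univ_iff_forall.1 hv ⟨C, hC⟩)
  obtain ⟨v₀, hv₀⟩ : ∃ v, (F v).Nonempty := by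
    by_contra! hno
    have hall := hconn {C₀} ⟨C₀, hC₀, rfl⟩ fun v C hC D _ hv _ _ =>
      absurd (show (⟨C, hC⟩ : {C // C ∈ L}) ∈ F v from hv) (by simp [hno v])
    have : L.length ≤ 1 := by
      rw [← List.toFinset_card_of_nodup hnd]
      refine Finset.card_le_one.2 fun C hC D hD => ?_
      rw [hall C (List.mem_toFinset.1 hC), hall D (List.mem_toFinset.1 hD)]
    omega
  have : Finite {C // C ∈ L} := L.finite_toSet
  obtain ⟨_, ho, ⟨o, rfl⟩, hmax⟩ :=
    (Set.toFinite (Set.range F)).exists_le_maximal ⟨v₀, rfl⟩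
  have hcov : ∀ x, ∃ v ∈ overlapComponent F o, x ∈ F v := by
    refine overlapComponent_covers (hv₀.mono ho) (fun v hv => hmax ⟨v, rfl⟩ hv) ?_
    rintro Y ⟨C, hC⟩ hY
    have := hconn {C | ∃ h : C ∈ L, ⟨C, h⟩ ∈ Y} ⟨C.1, C.2, C.2, hC⟩ (by
      rintro v C hC D hD hvC hvD ⟨_, hCY⟩
      exact ⟨hD, hY v ⟨⟨C, hC⟩, hvC, hCY⟩ hvD⟩)
    exact Set.eq_univ_of_forall fun D => (this D.1 D.2).2
  have hconv : ∀ {L' : List (Finset V)}, L'.Perm L → ConsecutiveList L' →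
      ∀ v, ConvexPos (pos L L') (F v) := fun hp hc v => hc.convexPos hp v
  have hover : ∀ v ∈ overlapComponent F o, ∃ w, Overlap (F v) (F w) := fun v hv =>
    exists_overlap_of_mem hFU hcov hv
  have hoo : o ∈ overlapComponent F o := Relation.ReflTransGen.refl
  obtain ⟨k, c, hmono, hcr, hsurj⟩ := exists_class_function hL
    (fun C D => ∀ v ∈ overlapComponent F o, (v ∈ C ↔ v ∈ D)) (fun _ _ _ => Iff.rfl)
    (fun _ _ h v hv => (h v hv).symm) (fun _ _ _ h h' v hv => (h v hv).trans (h' v hv)) (by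
      intro i j k hij hjk h
      have h1 : SameAtom F o ⟨_, L.get_mem i⟩ ⟨_, L.get_mem k⟩ := h
      refine h1.of_between (y := ⟨_, L.get_mem j⟩) (hconv (.refl L) hcons) hcov ?_ ?_ <;>
        simpa [pos, hnd.idxOf_getElem])
  have hatom : ∀ C D : {C // C ∈ L}, c C.1 = c D.1 ↔ SameAtom F o C D :=
    fun C D => hcr _ C.2 _ D.2
  have hpair : ∀ {x y : {C // C ∈ L}} {v}, v ∈ overlapComponent F o → x ∈ F v → y ∉ F v →
      c x.1 ≠ c y.1 := fun hv hx hy h => hy (((hatom _ _).1 h _ hv).1 hx)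
  obtain ⟨w, how⟩ := hover o hoo
  have hw := mem_overlapComponent_of_overlap hoo how
  -- The intersection and the two differences of an overlapping pair lie in three different atoms.
  have hk : 3 ≤ k := by
    obtain ⟨m, hm⟩ := how.1
    obtain ⟨x, hx⟩ := how.2.1
    obtain ⟨y, hy⟩ := how.2.2
    have h1 := Fin.val_ne_of_ne (hpair hw hm.2 hx.2)
    have h2 := Fin.val_ne_of_ne (hpair hoo hm.1 hy.2)
    have h3 := Fin.val_ne_of_ne (hpair hoo hx.1 hy.2)
    have := (c m.1).2
    have := (c x.1).2
    have := (c y.1).2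
    omega
  have hle : ∀ {C D : {C // C ∈ L}}, pos L L C < pos L L D → c C.1 ≤ c D.1 := fun {C D} h =>
    of_pairwise_of_idxOf_lt hmono C.2 D.2 (pos_lt_pos.1 h)
  have hrange : ∀ v, ∃ a b : Fin k, v ∈ overlapComponent F o →
      (a < b ∧ ¬ ((a : ℕ) = 0 ∧ (b : ℕ) + 1 = k)) ∧
        ∀ C ∈ L, v ∈ C ↔ a ≤ c C ∧ c C ≤ b := by
    intro v
    by_cases hv : v ∈ overlapComponent F o
    swap
    -- Arbitrary values: only vertices of the component are stored in the node.
    · exact ⟨⟨0, by omega⟩, ⟨0, by omega⟩, fun h => absurd h hv⟩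
    obtain ⟨u, hu⟩ := hover v hv
    have huo := mem_overlapComponent_of_overlap hv hu
    have hne : (F v).Nonempty := hu.1.mono Set.inter_subset_left
    obtain ⟨A, hA, hAmin⟩ :=
      Set.exists_min_image (F v) (fun C => c C.1) (Set.toFinite _) hne
    obtain ⟨B, hB, hBmax⟩ :=
      Set.exists_max_image (F v) (fun C => c C.1) (Set.toFinite _) hne
    have hiff : ∀ C ∈ L, v ∈ C ↔ c A.1 ≤ c C ∧ c C ≤ c B.1 := by
      intro C hC
      refine ⟨fun h => ⟨hAmin ⟨C, hC⟩ h, hBmax ⟨C, hC⟩ h⟩, fun ⟨h1, h2⟩ => ?_⟩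
      rcases h1.eq_or_lt with h1 | h1
      · exact ((hatom A ⟨C, hC⟩).1 h1 v hv).1 hA
      rcases h2.eq_or_lt with h2 | h2
      · exact ((hatom ⟨C, hC⟩ B).1 h2 v hv).2 hB
      refine hconv (.refl L) hcons v A ⟨C, hC⟩ B hA hB ?_ ?_
      · by_contra! hlt
        exact absurd (hle hlt) (not_le_of_gt h1)
      · by_contra! hlt
        exact absurd (hle hlt) (not_le_of_gt h2)
    -- A set overlapping `F v` separates two points of `F v`, which gives two sections, and has a
    -- point outside `F v`, so `v` misses some section.
    refine ⟨c A.1, c B.1, fun _ => ⟨⟨?_, ?_⟩, hiff⟩⟩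
    · obtain ⟨m, hm⟩ := hu.1
      obtain ⟨x, hx⟩ := hu.2.1
      have h1 := hpair huo hm.2 hx.2
      have h2 := (hiff _ m.2).1 hm.1
      have h3 := (hiff _ x.2).1 hx.1
      refine lt_of_le_of_ne (h2.1.trans h2.2) fun h => h1 ?_
      exact (le_antisymm (h2.2.trans h.ge) h2.1).trans (le_antisymm (h3.2.trans h.ge) h3.1).symm
    · rintro ⟨h1, h2⟩
      obtain ⟨y, hy⟩ := hu.2.2
      refine hy.2 ((hiff _ y.2).2 ⟨?_, ?_⟩) <;> rw [Fin.le_def]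
      · omega
      · have := (c y.1).2
        omega
  choose a b hab using hrange
  -- Since `V` may be infinite, the component is cut out of the vertices occurring in `L`; each
  -- member occurs there because its set is nonempty.
  let R : Finset V := (L.toFinset.biUnion id).filter fun v => v ∈ overlapComponent F o
  have hR : ∀ v, v ∈ R ↔ v ∈ overlapComponent F o := by
    intro v
    simp only [R, Finset.mem_filter, Finset.mem_biUnion, List.mem_toFinset, id,
      and_iff_right_iff_imp]
    intro hv
    obtain ⟨u, ⟨C, hC⟩, -⟩ := hover v hv
    exact ⟨C.1, C.2, hC.1⟩
  have hSC : ∀ C ∈ L, (fun i => R.filter fun v => a v ≤ i ∧ i ≤ b v) (c C) ⊆ C := by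
    intro C hC v hv
    obtain ⟨hvR, h⟩ := Finset.mem_filter.1 hv
    exact ((hab v ((hR v).1 hvR)).2 C hC).2 h
  choose T hT using fun i =>
    ih (block L c (fun i => R.filter fun v => a v ≤ i ∧ i ≤ b v) i)
      (length_block_lt (by omega) hsurj i) (block_ne_nil hsurj i) (nodup_block hnd hSC i)
      (hcons.block i)
  refine ⟨Q k _ _ T, trivial, isTreeOf_Q hk hmono hsurj (fun v hv => (hab v ((hR v).1 hv)).1)
    (fun v hv => (hab v ((hR v).1 hv)).2) ?_ hT ?_⟩
  · intro v hv C hC D hD hvC hvD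
    rw [hR] at hv
    exact (hatom ⟨C, hC⟩ ⟨D, hD⟩).2
      (sameAtom_of_not_mem_overlapComponent hFU hcov hv hvC hvD)
  · intro L' hL' hcons'
    have hp := pos_injective (.refl L)
    have hq := pos_injective hL'
    have hpF := hconv (.refl L) hcons
    have hqF := hconv hL' hcons'
    have hnd' := hL'.nodup_iff.2 hnd
    -- The orientation of the single pair `o`, `w` decides whether the whole node is kept or
    -- reversed.
    rcases agreeOn_or_agreeOn_neg hp hq (hpF o) (hpF w) (hqF o) (hqF w) how with h | h
    · left
      have hagree := agreeOn_overlapComponent hp hq hpF hqF hoo how h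
      refine pairwise_of_idxOf_lt hnd' fun C hC D hD hCD => ?_
      by_cases heq : c C = c D
      · exact heq.le
      have hC := hL'.mem_iff.1 hC
      have hD := hL'.mem_iff.1 hD
      exact hle ((lt_iff_lt_of_agreeOn (x := ⟨C, hC⟩) (y := ⟨D, hD⟩) hp hq hpF hqF hcov hagree
        fun h => heq ((hatom _ _).2 h)).2 (pos_lt_pos.2 hCD))
    · right
      have hq' : Function.Injective fun x => -pos L L' x := fun x y hxy => hq (neg_injective hxy)
      have hqF' := fun v => (hqF v).neg
      have hagree := agreeOn_overlapComponent hp hq' hpF hqF' hoo how h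
      refine pairwise_of_idxOf_lt hnd' fun C hC D hD hCD => ?_
      by_cases heq : c D = c C
      · exact heq.le
      have hC := hL'.mem_iff.1 hC
      have hD := hL'.mem_iff.1 hD
      exact hle ((lt_iff_lt_of_agreeOn (x := ⟨D, hD⟩) (y := ⟨C, hC⟩) hp hq' hpF hqF' hcov hagree
        fun h => heq ((hatom _ _).2 h)).2
          (neg_lt_neg (pos_lt_pos (C := ⟨C, hC⟩) (D := ⟨D, hD⟩).2 hCD)))

theorem exists_isTreeOf (L : List (Finset V)) (hL : L ≠ []) (hnd : L.Nodup)
    (hcons : ConsecutiveList L) : ∃ T, IsTreeOf L T := by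
  induction hn : L.length using Nat.strong_induction_on generalizing L with
  | _ n ih =>
  subst hn
  have ih : ∀ L' : List (Finset V), L'.length < L.length → L' ≠ [] → L'.Nodup →
      ConsecutiveList L' → ∃ T, IsTreeOf L' T :=
    fun L' hlt h1 h2 h3 => ih _ hlt L' h1 h2 h3 rfl
  by_cases hlen : L.length < 2
  · have hpos := List.length_pos_iff.2 hL
    obtain ⟨C, rfl⟩ := List.length_eq_one_iff.1 (by omega : L.length = 1)
    exact ⟨_, isTreeOf_singleton C⟩
  push Not at hlen
  obtain ⟨C₀, hC₀⟩ := List.exists_mem_of_ne_nil L hL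
  let U : Finset V := C₀.filter fun v => ∀ C ∈ L, v ∈ C
  have hU : ∀ v, v ∈ U ↔ ∀ C ∈ L, v ∈ C := by
    intro v
    simp only [U, Finset.mem_filter, and_iff_right_iff_imp]
    exact fun h => h C₀ hC₀
  have hUC : ∀ C ∈ L, U ⊆ C := fun C hC v hv => (hU v).1 hv C hC
  have hcontig := fun L' (hL' : L'.Perm L) (hc : ConsecutiveList L') (i j k : Fin L'.length) =>
    reflTransGen_of_between (U := U) (i := i) (j := j) (k := k) hnd hL' hc
  obtain ⟨k, c, hmono, hcr, hsurj⟩ := exists_class_function hL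
    (Relation.ReflTransGen (SharesVertex L U))
    (fun _ => .refl)
    (fun _ _ h => Std.Symm.symm _ _ h)
    (fun _ _ _ h h' => h.trans h') (hcontig L (.refl L) hcons)
  -- With several classes the root is a P-node, even if `U` is empty. With one class, deleting `U`
  -- leaves a connected family without common vertices, hence a Q-node.
  by_cases hk : 2 ≤ k
  · choose T hT using fun i => ih (block L c (fun _ => U) i) (length_block_lt hk hsurj i)
      (block_ne_nil hsurj i) (nodup_block (S := fun _ => U) hnd hUC i) (hcons.block i)
    refine ⟨_, isTreeOf_P (by omega) hUC hmono hsurj hT (by omega) ?_ ?_⟩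
    · intro v hv C hC D hD hvC hvD
      exact (hcr C hC D hD).2 (.single ⟨hC, hD, v, hv, hvC, hvD⟩)
    · intro L' hL' hcons'
      refine exists_perm_pairwise (fun h => hL (by simpa [h] using hL'.symm)) (fun i => ?_) ?_
      · obtain ⟨C, hC, h⟩ := hsurj i
        exact ⟨C, hL'.mem_iff.2 hC, h⟩
      · intro i j l hij hjl
        have hm : ∀ i, L'.get i ∈ L := fun i => hL'.mem_iff.1 (L'.get_mem i)
        rw [hcr _ (hm i) _ (hm j), hcr _ (hm i) _ (hm l)]
        exact hcontig L' hL' hcons' i j l hij hjl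
  · have hone : ∀ C ∈ L, ∀ D ∈ L, c C = c D := by
      intro C _ D _
      have := (c C).2
      have := (c D).2
      exact Fin.ext (by omega)
    obtain ⟨T, hTQ, hT⟩ := exists_isQ_isTreeOf (L := L.map (· \ U)) (nodup_map_sdiff hnd hUC)
      (hcons.map_sdiff U) (by simpa using hlen) (by
        intro v
        by_cases hv : v ∈ U
        · exact ⟨_, List.mem_map_of_mem hC₀, by simp [hv]⟩
        · rw [hU] at hv
          push Not at hv
          obtain ⟨C, hC, hvC⟩ := hv
          exact ⟨_, List.mem_map_of_mem hC, by simp [hvC]⟩) (by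
        rintro Y ⟨_, hC, hCY⟩ hY _ hD
        obtain ⟨C, hCL, rfl⟩ := List.mem_map.1 hC
        obtain ⟨D, hDL, rfl⟩ := List.mem_map.1 hD
        have hCD := (hcr C hCL D hDL).1 (hone C hCL D hDL)
        clear hD hDL
        induction hCD with
        | refl => exact hCY
        | @tail D E hCD hDE ih' =>
          obtain ⟨hD, hE, v, hvU, hvD, hvE⟩ := hDE
          exact hY v _ (List.mem_map_of_mem hD) _ (List.mem_map_of_mem hE)
            (Finset.mem_sdiff.2 ⟨hvD, hvU⟩) (Finset.mem_sdiff.2 ⟨hvE, hvU⟩) ih') (by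
        simpa using ih)
    -- A P-node with a single subtree must store a vertex, so it is added only for nonempty `U`.
    by_cases hUe : U = ∅
    · rw [hUe] at hT
      exact ⟨T, by simpa using hT⟩
    · refine ⟨_, isTreeOf_P (k := 1) (c := fun _ => 0) (T := fun _ => T) one_ne_zero hUC
        (List.pairwise_of_forall fun _ _ => le_rfl) (fun i => ⟨C₀, hC₀, Subsingleton.elim _ _⟩)
        (fun i => ?_) (fun _ => ⟨Finset.nonempty_iff_ne_empty.2 hUe, fun _ => hTQ⟩)
        (fun _ _ _ _ _ _ _ _ => rfl)
        fun L' _ _ => ⟨1, List.pairwise_of_forall fun _ _ => le_rfl⟩⟩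
      have : block L (fun _ => (0 : Fin 1)) (fun _ => U) i = L.map (· \ U) := by
        simp [block, Subsingleton.elim i 0]
      rwa [this]

theorem IsTreeOf.represents {G : SimpleGraph V} [Finite V] {L : List (Finset V)}
    (hL : IsConsecutiveCliqueOrder G L) {T : MPQTree V} (hT : IsTreeOf L T) :
    T.Represents G := by
  refine ⟨hT.normal, hT.vertices_nodup, fun v => ?_, hT.frontier_eq.symm ▸ hL, fun L' hL' => ?_⟩
  · obtain ⟨C, hvC, hC⟩ := exists_maximal_isClique G (s := {v}) (by simp)
    exact (hT.mem_vertices v).2 ⟨C, (hL.mem_iff C).2 hC, hvC (by simp)⟩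
  · refine hT.complete L' ?_ hL'.consecutive
    rw [List.perm_ext_iff_of_nodup hL'.nodup hL.nodup]
    exact fun C => (hL'.mem_iff C).trans (hL.mem_iff C).symm

theorem exists_represents [Finite V] {G : SimpleGraph V} (hG : IsIntervalGraph G) :
    ∃ T : MPQTree V, T.Represents G := by
  obtain ⟨L, hL⟩ := hG.exists_isConsecutiveCliqueOrder
  obtain ⟨C, -, hC⟩ := exists_maximal_isClique G (s := ∅) (by simp)
  obtain ⟨T, hT⟩ := exists_isTreeOf L (List.ne_nil_of_mem ((hL.mem_iff C).2 hC)) hL.nodup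
    hL.consecutive
  exact ⟨T, hT.represents hL⟩

end MPQTree

/-! ### Canonical strings characterize isomorphism -/

theorem IsIntervalGraph.existsUnique_isCanonicalString {n : ℕ} {G : SimpleGraph (Fin n)}
    (hG : IsIntervalGraph G) : ∃! S : List ℕ, IsCanonicalString G S := by
  obtain ⟨T, hT⟩ := MPQTree.exists_isCanonical (MPQTree.exists_represents hG)
  refine ⟨_, ⟨T, hT, rfl⟩, ?_⟩
  rintro _ ⟨T', hT', rfl⟩
  exact hT'.normalizedString_eq .refl hT

theorem mainTheorem6 {n m : ℕ} (G₁ : SimpleGraph (Fin n)) (G₂ : SimpleGraph (Fin m))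
    (h₁ : IsIntervalGraph G₁) (h₂ : IsIntervalGraph G₂) :
    (∃! S : List ℕ, IsCanonicalString G₁ S) ∧
    (∃! S : List ℕ, IsCanonicalString G₂ S) ∧
    ∀ S₁ S₂ : List ℕ, IsCanonicalString G₁ S₁ → IsCanonicalString G₂ S₂ →
      (Nonempty (G₁ ≃g G₂) ↔ S₁ = S₂) := by
  refine ⟨h₁.existsUnique_isCanonicalString, h₂.existsUnique_isCanonicalString, ?_⟩
  rintro _ _ ⟨T₁, hT₁, rfl⟩ ⟨T₂, hT₂, rfl⟩
  constructor
  · rintro ⟨φ⟩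
    -- Canonicity compares trees on a common vertex set, so the numbers of vertices are identified
    -- before invariance is applied.
    obtain rfl : n = m := by simpa using Fintype.card_congr φ.toEquiv
    exact hT₁.normalizedString_eq φ hT₂
  · exact hT₁.1.nonempty_iso hT₂.1
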